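/- **Sedgewick's dual pivot Quicksort.** To sort the index range $left,\dots,right$ of an array $A$, the program does nothing if $right-left<1$. Otherwise it sets $i=i_1=left$, $j=j_1=right$, $p=A[left]$, $q=A[right]$, compares $p$ with $q$ and exchanges these two variables if $p>q$. Then it repeats the following outer loop. 1. $i\leftarrow i+1$; while $A[i]\le q$ do: if $i\ge j$, leave the outer loop; if $A[i]<p$ then $A[i_1]\leftarrow A[i]$, $i_1\leftarrow i_1+1$, $A[i]\leftarrow A[i_1]$; $i\leftarrow i+1$. 2. $j\leftarrow j-1$; while $A[j]\ge p$ do: if $A[j]>q$ then $A[j_1]\leftarrow A[j]$, $j_1\leftarrow j_1-1$, $A[j]\leftarrow A[j_1]$; if $i\ge j$, leave the outer loop; $j\leftarrow j-1$. 3. $A[i_1]\leftarrow A[j]$; $A[j_1]\leftarrow A[i]$; $i_1\leftarrow i_1+1$; $j_1\leftarrow j_1-1$; $A[i]\leftarrow A[i_1]$; $A[j]\leftarrow A[j_1]$. After the outer loop it sets $A[i_1]\leftarrow p$, $A[j_1]\leftarrow q$. This ends the partitioning step. Finally it calls itself on $left,\dots,i_1-1$, then on $i_1+1,\dots,j_1-1$,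 then on $j_1+1,\dots,right$. *Comparisons* are the evaluations of $p>q$, $A[i]\le q$, $A[i]<p$, $A[j]\ge p$ and $A[j]>q$. *Swaps* are counted as follows: one for the exchange of $p$ and $q$ (if it is made), one for each execution of the assignments after "then" in 1 or in 2, two for each execution of 3, and two for putting the pivots $p$ and $q$ into their final positions. **Theorem.** The program terminates on every permutation of $\{1,\dots,n\}$, for every $n\ge0$. Let $C_n$ and $S_n$ be the expected numbers of comparisons and of swaps that it makes on $A[1],\dots,A[n]$ holding a uniformly random permutation of $\{1,\dots,n\}$, let $\mathcal H_n=\sum_{k=1}^n\frac1k$, and let $\gamma$ be the Euler–Mascheroni constant. Then for all $n\ge4$ $$C_n=\tfrac{32}{15}(n+1)\mathcal H_{n+1}-\tfrac{856}{225}(n+1)+\tfrac32,\qquad S_n=\tfrac45(n+1)\mathcal H_{n+1}-\tfrac{19}{25}(n+1)-\tfrac14,$$ and, as $n\to\infty$, $$C_n=\tfrac{32}{15}\,n\ln n+\bigl(\tfrac{32}{15}\gamma-\tfrac{856}{225}\bigr)n+\mathcal O(\ln n),\qquad S_n=\tfrac45\,n\ln n+\bigl(\tfrac45\gamma-\tfrac{19}{25}\bigr)n+\mathcal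 O(\ln n),$$ where, rounded to two decimals (error less than $0.005$), $\frac{32}{15}\approx2.13$, $\frac{32}{15}\gamma-\frac{856}{225}\approx-2.57$ and $\frac45\gamma-\frac{19}{25}\approx-0.30$. Moreover, for all $n\ge3$ the first partitioning step terminates on every permutation of $\{1,\dots,n\}$, and on a uniformly random one it makes on average $\frac{16}{9}(n+1)-3-\frac23\cdot\frac1{n(n-1)}$ comparisons and $\frac23(n+1)+\frac12$ swaps. -/

import Mathlib

open Asymptotics Filter

namespace SedgewickQuicksort

/-- The memory of the program: the array `arr` (cells are indexed by integers, keys are natural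
numbers), together with the number of key comparisons and of swaps made so far. -/
structure Mem where
  arr : ℤ → ℕ
  comps : ℕ
  swaps : ℕ

/-- The state inside a partitioning step: the memory and the four pointers `i`, `i₁`, `j`, `j₁`. -/
structure State extends Mem where
  i : ℤ
  i₁ : ℤ
  j : ℤ
  j₁ : ℤ

namespace State

/-- The assignment `A[k] ← x`. -/
def write (s : State) (k : ℤ) (x : ℕ) : State :=
  { s with arr := Function.update s.arr k x }

/-- Count one key comparison. -/
def countComp (s : State) : State := { s with comps := s.comps + 1 }

/-- Count `k` swaps. -/
def countSwaps (s : State) (k : ℕ) : State := { s with swaps := s.swaps + k }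

/-- `A[i₁] ← A[i]; i₁ ← i₁ + 1; A[i] ← A[i₁]`. This is one swap. -/
def moveSmall (s : State) : State :=
  let s := s.write s.i₁ (s.arr s.i)
  let s := { s with i₁ := s.i₁ + 1 }
  let s := s.write s.i (s.arr s.i₁)
  s.countSwaps 1

/-- `A[j₁] ← A[j]; j₁ ← j₁ - 1; A[j] ← A[j₁]`. This is one swap. -/
def moveLarge (s : State) : State :=
  let s := s.write s.j₁ (s.arr s.j)
  let s := { s with j₁ := s.j₁ - 1 }
  let s := s.write s.j (s.arr s.j₁)
  s.countSwaps 1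

/-- `A[i₁] ← A[j]; A[j₁] ← A[i]; i₁ ← i₁ + 1; j₁ ← j₁ - 1; A[i] ← A[i₁]; A[j] ← A[j₁]`.
Two keys are moved to their subfiles, so these are two swaps. -/
def exchange (s : State) : State :=
  let s := s.write s.i₁ (s.arr s.j)
  let s := s.write s.j₁ (s.arr s.i)
  let s := { s with i₁ := s.i₁ + 1, j₁ := s.j₁ - 1 }
  let s := s.write s.i (s.arr s.i₁)
  let s := s.write s.j (s.arr s.j₁)
  s.countSwaps 2

end State

/-- The first inner loop, with pivots `p` and `q`:

`while A[i] ≤ q do`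
`  if i ≥ j then break outer while;`
`  if A[i] < p then (A[i₁] ← A[i]; i₁ ← i₁ + 1; A[i] ← A[i₁]);`
`  i ← i + 1`

The Boolean in the result is `true` if the outer loop has to be left.
In all loops below `none` means that the loop does not terminate. -/
noncomputable def scanUp (p q : ℕ) (s : State) : Option (Bool × State) :=
  if s.arr s.i ≤ q then
    let s := s.countComp
    if s.i ≥ s.j then some (true, s)
    else
      let s := if s.arr s.i < p then s.countComp.moveSmall else s.countComp
      scanUp p q { s with i := s.i + 1 }
  else some (false, s.countComp)
  partial_fixpoint

/-- The second inner loop, with pivots `p` and `q`: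

`while A[j] ≥ p do`
`  if A[j] > q then (A[j₁] ← A[j]; j₁ ← j₁ - 1; A[j] ← A[j₁]);`
`  if i ≥ j then break outer while;`
`  j ← j - 1` -/
noncomputable def scanDown (p q : ℕ) (s : State) : Option (Bool × State) :=
  if s.arr s.j ≥ p then
    let s := s.countComp
    let s := if s.arr s.j > q then s.countComp.moveLarge else s.countComp
    if s.i ≥ s.j then some (true, s)
    else scanDown p q { s with j := s.j - 1 }
  else some (false, s.countComp)
  partial_fixpoint

/-- The outer loop `while true do …` with pivots `p` and `q`. -/
noncomputable def outerLoop (p q : ℕ) (s : State) : Option State := do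
  let (crossed, s) ← scanUp p q { s with i := s.i + 1 }
  if crossed then return s
  let (crossed, s) ← scanDown p q { s with j := s.j - 1 }
  if crossed then return s
  outerLoop p q s.exchange
  partial_fixpoint

/-- The partitioning step on the index range `left, …, right`. The local variables `p` and `q`
receive the first and the last key; they are compared (one key comparison) and, if `p > q`,
exchanged (one swap). After the outer loop both pivots are put in their final positions `i₁` and
`j₁` (one swap for each pivot). -/
noncomputable def partitionStep (m : Mem) (left right : ℤ) : Option State := do
  let p := m.arr left
  let q := m.arr right
  let s : State := { m with i := left, i₁ := left, j := right, j₁ := right }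
  let s := s.countComp
  let s := if p > q then s.countSwaps 1 else s
  let p' := if p > q then q else p
  let q' := if p > q then p else q
  let s ← outerLoop p' q' s
  return ((s.write s.i₁ p').write s.j₁ q').countSwaps 2

/-- Sedgewick's dual pivot Quicksort on the index range `left, …, right`. -/
noncomputable def quicksort (m : Mem) (left right : ℤ) : Option Mem := do
  if right - left ≥ 1 then
    let s ← partitionStep m left right
    let m ← quicksort s.toMem left (s.i₁ - 1)
    let m ← quicksort m (s.i₁ + 1) (s.j₁ - 1)
    quicksort m (s.j₁ + 1) right
  else return m
  partial_fixpoint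

/-- The initial memory for a permutation of `{1, …, n}`: the array cells `A[1], …, A[n]` hold the
permutation (both indices and values are shifted by one because `Fin n` starts with `0`), and
nothing has been counted yet. -/
def input {n : ℕ} (π : Equiv.Perm (Fin n)) : Mem where
  arr k := if h : 1 ≤ k ∧ k ≤ n then (π ⟨(k - 1).toNat, by omega⟩ : ℕ) + 1 else 0
  comps := 0
  swaps := 0

/-- Sorting the whole array `A[1], …, A[n]`. -/
noncomputable def run {n : ℕ} (π : Equiv.Perm (Fin n)) : Option Mem :=
  quicksort (input π) 1 n

/-- The first partitioning step on the array `A[1], …, A[n]`. -/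
noncomputable def runFirstStep {n : ℕ} (π : Equiv.Perm (Fin n)) : Option State :=
  partitionStep (input π) 1 n

/-- The mean of `f` over all permutations, each having probability `1 / n!`. -/
noncomputable def mean {n : ℕ} (f : Equiv.Perm (Fin n) → ℕ) : ℝ :=
  ∑ π : Equiv.Perm (Fin n), (1 / (n.factorial : ℝ)) * (f π : ℝ)

/-- Expected number of key comparisons for sorting a random permutation of length `n`. (The
default value `0` is irrelevant as soon as the program is known to terminate.) -/
noncomputable def expComparisons (n : ℕ) : ℝ :=
  mean fun π : Equiv.Perm (Fin n) => ((run π).map Mem.comps).getD 0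

/-- Expected number of swaps for sorting a random permutation of length `n`. -/
noncomputable def expSwaps (n : ℕ) : ℝ :=
  mean fun π : Equiv.Perm (Fin n) => ((run π).map Mem.swaps).getD 0

/-- Expected number of key comparisons in the first partitioning step. -/
noncomputable def expStepComparisons (n : ℕ) : ℝ :=
  mean fun π : Equiv.Perm (Fin n) => ((runFirstStep π).map fun s => s.comps).getD 0

/-- Expected number of swaps in the first partitioning step. -/
noncomputable def expStepSwaps (n : ℕ) : ℝ :=
  mean fun π : Equiv.Perm (Fin n) => ((runFirstStep π).map fun s => s.swaps).getD 0

end SedgewickQuicksort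

/-! The cost of one partitioning step is a function of a few statistics of the input. Let `s` and
`L` be the numbers of keys below and above both pivots. A key passed by `i` or `j` costs two
comparisons, but each of the two keys of an exchange costs only one; comparing the pivots and the
end of the outer loop add one comparison each. With `x` exchanges and `n` keys this gives `2(n-1) -
2x` comparisons. Every small and every large key is moved once, which gives `s + L + 2` swaps, and
one more if the pivots are exchanged. The invariant `Inv` carries these counts through the loops,
and `partitionStep_spec` collects them.

The mean of `x` rests on the fact that `i₁` advances exactly when `i` passes a small key or a large
key that gets exchanged, and `i₁` ends at `l + s`. So `i` passes exactly the first `s` positions of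
non-medium keys, up to medium keys, and `x` is the number of large keys there. Permuting the
non-medium keys among themselves keeps these positions (`Family.exch_mul`), so the mean of `x` is
the hypergeometric mean `sL/(s+L)` (`Family.sum_exch`).

The subfiles are again random: relabelling the keys by a map that fixes the pivots and respects the
classes small, medium and large does not alter the path of the program, and the result is relabelled
in the same way (`State.Rel`). Hence, with the pivots fixed, averaging over the permutations of one
class reduces the cost of sorting that class to the cost of sorting a random file
(`Family.sum_subfile`).

Summing over the pairs of pivots gives the recurrence `k(k-1) C k = T k + 6 ∑_{j<k} ∑_{i<j} C i`
with an explicit polynomial `T` (`isMeanCost_of_recurrence`, `sum_stepMean`, `sum_recursive`). The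
double sum has second difference `C k`, so closed forms are checked by second differences and two
initial values (`double_sum_eq`). The asymptotics follow from `0 ≤ H_n - log n - γ ≤ 1/n`, and the
rounded coefficients from rational bounds for `γ`. -/

namespace SedgewickQuicksort

open Finset

/-! ### The assignments of the program, and their equivariance under relabelling of keys. -/

namespace State

theorem moveSmall_arr (s : State) :
    s.moveSmall.arr = Function.update (Function.update s.arr s.i₁ (s.arr s.i)) s.i
      (s.arr (s.i₁ + 1)) := by
  simp [moveSmall, write, countSwaps]

theorem moveLarge_arr (s : State) :
    s.moveLarge.arr = Function.update (Function.update s.arr s.j₁ (s.arr s.j)) s.j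
      (s.arr (s.j₁ - 1)) := by
  simp [moveLarge, write, countSwaps]

/-- The order of the pointers ensures that no later read sees a value written by this step. The
cases `i₁ + 1 = i` and `j₁ - 1 = j` are allowed: a key is then written back to its own cell. -/
theorem exchange_arr (s : State) (hi : s.i₁ < s.i) (hij : s.i < s.j) (hj : s.j < s.j₁) :
    s.exchange.arr = Function.update (Function.update (Function.update (Function.update
      s.arr s.i₁ (s.arr s.j)) s.j₁ (s.arr s.i)) s.i (s.arr (s.i₁ + 1))) s.j
      (s.arr (s.j₁ - 1)) := by
  have h1 : s.i ≠ s.i₁ := by omega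
  have h2 : s.i₁ + 1 ≠ s.j₁ := by omega
  have h3 : s.j₁ - 1 ≠ s.i := by omega
  have h4 : s.j₁ - 1 ≠ s.i₁ := by omega
  simp [exchange, write, countSwaps, Function.update_of_ne, h1, h2, h3, h4]

/-- The array with the two holes `i₁` and `j₁` filled by the pivots. -/
def filled (s : State) (p q : ℕ) : ℤ → ℕ :=
  Function.update (Function.update s.arr s.i₁ p) s.j₁ q

/-- Both states have the same pointers, and on the range `l, …, r` the array of the second one is
obtained from the array of the first one by applying `h` to all keys. -/
structure Rel (h : ℕ → ℕ) (l r : ℤ) (s s' : State) : Prop where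
  i : s'.i = s.i
  i₁ : s'.i₁ = s.i₁
  j : s'.j = s.j
  j₁ : s'.j₁ = s.j₁
  arr : ∀ k, l ≤ k → k ≤ r → s'.arr k = h (s.arr k)

namespace Rel

variable {h : ℕ → ℕ} {l r : ℤ} {s s' : State}

theorem countComp (H : Rel h l r s s') : Rel h l r s.countComp s'.countComp :=
  ⟨H.i, H.i₁, H.j, H.j₁, H.arr⟩

theorem setI (H : Rel h l r s s') {k k' : ℤ} (hk : k' = k) :
    Rel h l r { s with i := k } { s' with i := k' } :=
  ⟨hk, H.i₁, H.j, H.j₁, H.arr⟩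

theorem setJ (H : Rel h l r s s') {k k' : ℤ} (hk : k' = k) :
    Rel h l r { s with j := k } { s' with j := k' } :=
  ⟨H.i, H.i₁, hk, H.j₁, H.arr⟩

theorem moveSmall (H : Rel h l r s s') (h1 : l ≤ s.i₁) (h2 : s.i₁ < s.i) (h3 : s.i ≤ r) :
    Rel h l r s.moveSmall s'.moveSmall := by
  refine ⟨H.i, congrArg (· + 1) H.i₁, H.j, H.j₁, fun k hk hk' => ?_⟩
  simp only [moveSmall_arr, Function.update_apply, H.i, H.i₁]
  split_ifs <;> apply H.arr <;> omega

theorem moveLarge (H : Rel h l r s s') (h1 : s.j₁ ≤ r) (h2 : s.j < s.j₁) (h3 : l ≤ s.j) :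
    Rel h l r s.moveLarge s'.moveLarge := by
  refine ⟨H.i, H.i₁, H.j, congrArg (· - 1) H.j₁, fun k hk hk' => ?_⟩
  simp only [moveLarge_arr, Function.update_apply, H.j, H.j₁]
  split_ifs <;> apply H.arr <;> omega

theorem exchange (H : Rel h l r s s') (h1 : l ≤ s.i₁) (h2 : s.i₁ < s.i) (h3 : s.i < s.j)
    (h4 : s.j < s.j₁) (h5 : s.j₁ ≤ r) : Rel h l r s.exchange s'.exchange := by
  refine ⟨H.i, congrArg (· + 1) H.i₁, H.j, congrArg (· - 1) H.j₁, fun k hk hk' => ?_⟩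
  rw [exchange_arr s h2 h3 h4, exchange_arr s' (by rw [H.i, H.i₁]; exact h2)
    (by rw [H.i, H.j]; exact h3) (by rw [H.j, H.j₁]; exact h4)]
  simp only [Function.update_apply, H.i, H.i₁, H.j, H.j₁]
  split_ifs <;> apply H.arr <;> omega

end Rel

end State

/-! ### The loop invariant and its preservation. -/

/-- The invariant of a partitioning step on the range `l, …, r` of the array `A` with pivots
`p ≤ q`: the keys in the positions `a, …, b` have not been looked at yet, `x` exchanges have been
made, and `c` and `w` are offsets of the two counters. -/
structure Inv (A : ℤ → ℕ) (l r : ℤ) (p q : ℕ) (c w : ℤ) (s : State) (a b : ℤ) (x : ℕ) :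
    Prop where
  hl : l ≤ s.i₁
  ha : s.i₁ < a
  hab : a ≤ b + 1
  hb : b < s.j₁
  hr : s.j₁ ≤ r
  small : ∀ k, l ≤ k → k < s.i₁ → s.arr k < p
  medl : ∀ k, s.i₁ < k → k < a → p ≤ s.arr k ∧ s.arr k ≤ q
  rest : ∀ k, a ≤ k → k ≤ b → s.arr k = A k
  medr : ∀ k, b < k → k < s.j₁ → p ≤ s.arr k ∧ s.arr k ≤ q
  large : ∀ k, s.j₁ < k → k ≤ r → q < s.arr k
  perm : ∃ σ : Equiv.Perm ℤ, (∀ k, ¬ (l ≤ k ∧ k ≤ r) → σ k = k) ∧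
    ∀ k, s.filled p q k = A (σ k)
  exch : x = #{k ∈ Ioo l a | q < A k}
  left : s.i₁ - l = #{k ∈ Ioo l a | A k < p ∨ q < A k}
  comps : (s.comps : ℤ) = c + 2 * (a - 1 - l) + 2 * (r - b - 1) - 2 * x
  swaps : (s.swaps : ℤ) = w + (s.i₁ - l) + (r - s.j₁)

theorem card_filter_Ioo_succ (P : ℤ → Prop) [DecidablePred P] {l a : ℤ} (h : l < a) :
    #{k ∈ Ioo l (a + 1) | P k} = #{k ∈ Ioo l a | P k} + if P a then 1 else 0 := by
  have : Ioo l (a + 1) = insert a (Ioo l a) := by ext k; simp only [mem_Ioo, mem_insert]; omega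
  rw [this, filter_insert]
  split_ifs
  · rw [card_insert_of_notMem (by simp)]
  · rfl

theorem exists_perm_comp {A B B' : ℤ → ℕ} {l r : ℤ}
    (h : ∃ σ : Equiv.Perm ℤ, (∀ k, ¬ (l ≤ k ∧ k ≤ r) → σ k = k) ∧ ∀ k, B k = A (σ k))
    (τ : Equiv.Perm ℤ) (hτ : ∀ k, ¬ (l ≤ k ∧ k ≤ r) → τ k = k) (hB : ∀ k, B' k = B (τ k)) :
    ∃ σ : Equiv.Perm ℤ, (∀ k, ¬ (l ≤ k ∧ k ≤ r) → σ k = k) ∧ ∀ k, B' k = A (σ k) := by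
  obtain ⟨σ, h1, h2⟩ := h
  exact ⟨σ * τ, fun k hk => by simp [hτ k hk, h1 k hk], fun k => by simp [hB, h2]⟩

namespace Inv

variable {A : ℤ → ℕ} {l r : ℤ} {p q : ℕ} {c w : ℤ} {s : State} {a b : ℤ} {x : ℕ}

theorem medium (H : Inv A l r p q c w s a b x) (hab : a ≤ b) (h1 : p ≤ s.arr a)
    (h2 : s.arr a ≤ q) : Inv A l r p q c w s.countComp.countComp (a + 1) b x where
  hl := H.hl
  ha := H.ha.trans (lt_add_one a)
  hab := by omega
  hb := H.hb
  hr := H.hr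
  small := H.small
  medl k hk hk' := by
    rcases eq_or_ne k a with rfl | h
    · exact ⟨h1, h2⟩
    · exact H.medl k hk (by omega)
  rest k hk := H.rest k (by omega)
  medr := H.medr
  large := H.large
  perm := H.perm
  exch := by
    have := H.rest a le_rfl hab
    rw [card_filter_Ioo_succ _ (by have := H.hl; have := H.ha; omega), ← H.exch, if_neg (by omega)]
    rfl
  left := by
    have := H.rest a le_rfl hab
    rw [card_filter_Ioo_succ _ (by have := H.hl; have := H.ha; omega), if_neg (by omega), add_zero]
    exact H.left
  comps := by
    have := H.comps
    simp only [State.countComp]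
    push_cast
    omega
  swaps := H.swaps

theorem moveSmall (H : Inv A l r p q c w s a b x) (hab : a ≤ b) (hi : s.i = a)
    (h1 : s.arr a < p) (hpq : p ≤ q) :
    Inv A l r p q c w s.countComp.countComp.moveSmall (a + 1) b x := by
  have Ha := H.ha
  have Hb := H.hb
  have Hl := H.hl
  have Hr := H.hr
  have hA := H.rest a le_rfl hab
  have harr : s.countComp.countComp.moveSmall.arr = Function.update (Function.update s.arr s.i₁
      (s.arr a)) a (s.arr (s.i₁ + 1)) := by rw [State.moveSmall_arr, ← hi]; rfl
  have hi₁ : s.countComp.countComp.moveSmall.i₁ = s.i₁ + 1 := rfl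
  have hj₁ : s.countComp.countComp.moveSmall.j₁ = s.j₁ := rfl
  refine ⟨?_, ?_, ?_, ?_, ?_, ?_, ?_, ?_, ?_, ?_, ?_, ?_, ?_, ?_, ?_⟩ <;>
    (try simp only [harr, hi₁, hj₁])
  · omega
  · omega
  · omega
  · omega
  · omega
  · intro k hk hk'
    have := H.small k hk
    simp only [Function.update_apply]
    split_ifs <;> grind
  · intro k hk hk'
    simp only [Function.update_apply]
    split_ifs with h h'
    · exact H.medl _ (by omega) (by omega)
    · omega
    · exact H.medl _ (by omega) (by omega)
  · intro k hk hk'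
    simp only [Function.update_apply]
    rw [if_neg (by omega), if_neg (by omega)]
    exact H.rest _ (by omega) (by omega)
  · intro k hk hk'
    simp only [Function.update_apply]
    rw [if_neg (by omega), if_neg (by omega)]
    exact H.medr _ (by omega) (by omega)
  · intro k hk hk'
    simp only [Function.update_apply]
    rw [if_neg (by omega), if_neg (by omega)]
    exact H.large _ (by omega) (by omega)
  -- With the pivots put into the holes, the move is a 3-cycle: the key at `a` goes to `i₁`, the
  -- pivot to `i₁ + 1`, and the medium key from there to `a`. It degenerates to a transposition if
  -- `i₁ + 1 = a`.
  · refine exists_perm_comp H.perm (Equiv.swap s.i₁ a * Equiv.swap (s.i₁ + 1) a) ?_ ?_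
    · intro k hk
      simp only [Equiv.Perm.mul_apply, Equiv.swap_apply_def]
      grind
    · intro k
      simp only [Equiv.Perm.mul_apply, State.filled, harr, hi₁, hj₁, Function.update_apply,
        Equiv.swap_apply_def]
      grind
  · rw [card_filter_Ioo_succ _ (by omega), ← H.exch, if_neg (by omega)]
    rfl
  · rw [card_filter_Ioo_succ _ (by omega), if_pos (by omega)]
    have := H.left
    push_cast
    omega
  · have := H.comps
    simp only [State.countComp, State.moveSmall, State.write, State.countSwaps]
    push_cast
    omega
  · have := H.swaps
    simp only [State.countComp, State.moveSmall, State.write, State.countSwaps]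
    push_cast
    omega

theorem medium' (H : Inv A l r p q c w s a b x) (hab : a ≤ b) (h1 : p ≤ s.arr b)
    (h2 : s.arr b ≤ q) : Inv A l r p q c w s.countComp.countComp a (b - 1) x where
  hl := H.hl
  ha := H.ha
  hab := by omega
  hb := by have := H.hb; change b - 1 < s.j₁; omega
  hr := H.hr
  small := H.small
  medl := H.medl
  rest k hk hk' := H.rest k hk (by omega)
  medr k hk hk' := by
    rcases eq_or_ne k b with rfl | h
    · exact ⟨h1, h2⟩
    · exact H.medr k (by omega) hk'
  large := H.large
  perm := H.perm
  exch := H.exch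
  left := H.left
  comps := by
    have := H.comps
    simp only [State.countComp]
    push_cast
    omega
  swaps := H.swaps

theorem moveLarge (H : Inv A l r p q c w s a b x) (hab : a ≤ b) (hj : s.j = b)
    (h1 : q < s.arr b) : Inv A l r p q c w s.countComp.countComp.moveLarge a (b - 1) x := by
  have Ha := H.ha
  have Hb := H.hb
  have Hl := H.hl
  have Hr := H.hr
  have harr : s.countComp.countComp.moveLarge.arr = Function.update (Function.update s.arr s.j₁
      (s.arr b)) b (s.arr (s.j₁ - 1)) := by rw [State.moveLarge_arr, ← hj]; rfl
  have hi₁ : s.countComp.countComp.moveLarge.i₁ = s.i₁ := rfl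
  have hj₁ : s.countComp.countComp.moveLarge.j₁ = s.j₁ - 1 := rfl
  refine ⟨?_, ?_, ?_, ?_, ?_, ?_, ?_, ?_, ?_, ?_, ?_, H.exch, H.left, ?_, ?_⟩ <;>
    (try simp only [harr, hi₁, hj₁])
  · omega
  · omega
  · omega
  · omega
  · omega
  · intro k hk hk'
    simp only [Function.update_apply]
    rw [if_neg (by omega), if_neg (by omega)]
    exact H.small _ (by omega) (by omega)
  · intro k hk hk'
    simp only [Function.update_apply]
    rw [if_neg (by omega), if_neg (by omega)]
    exact H.medl _ (by omega) (by omega)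
  · intro k hk hk'
    simp only [Function.update_apply]
    rw [if_neg (by omega), if_neg (by omega)]
    exact H.rest _ (by omega) (by omega)
  · intro k hk hk'
    simp only [Function.update_apply]
    split_ifs with h h'
    · exact H.medr _ (by omega) (by omega)
    · omega
    · exact H.medr _ (by omega) (by omega)
  · intro k hk hk'
    have := H.large k
    simp only [Function.update_apply]
    split_ifs <;> grind
  · refine exists_perm_comp H.perm (Equiv.swap s.j₁ b * Equiv.swap (s.j₁ - 1) b) ?_ ?_
    · intro k hk
      simp only [Equiv.Perm.mul_apply, Equiv.swap_apply_def]
      grind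
    · intro k
      simp only [Equiv.Perm.mul_apply, State.filled, harr, hi₁, hj₁, Function.update_apply,
        Equiv.swap_apply_def]
      grind
  · have := H.comps
    simp only [State.countComp, State.moveLarge, State.write, State.countSwaps]
    push_cast
    omega
  · have := H.swaps
    simp only [State.countComp, State.moveLarge, State.write, State.countSwaps]
    push_cast
    omega

/-- The two scans that stopped at `a` and `b` have added one comparison each to the offset `c`. Two
processed keys at the usual price of two comparisons, less the discount of two for the exchange,
account for both, so the offset drops by two. This exchange is also the only step in which a large
key is passed by `i`. -/
theorem exchange (H : Inv A l r p q c w s a b x) (hab : a < b) (hi : s.i = a) (hj : s.j = b)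
    (h1 : q < s.arr a) (h2 : s.arr b < p) :
    Inv A l r p q (c - 2) w s.exchange (a + 1) (b - 1) (x + 1) := by
  have Ha := H.ha
  have Hb := H.hb
  have Hl := H.hl
  have Hr := H.hr
  have hA := H.rest a le_rfl hab.le
  have harr := State.exchange_arr s (by omega) (by omega) (by omega)
  rw [hi, hj] at harr
  have hi₁ : s.exchange.i₁ = s.i₁ + 1 := rfl
  have hj₁ : s.exchange.j₁ = s.j₁ - 1 := rfl
  refine ⟨?_, ?_, ?_, ?_, ?_, ?_, ?_, ?_, ?_, ?_, ?_, ?_, ?_, ?_, ?_⟩ <;>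
    (try simp only [harr, hi₁, hj₁])
  · omega
  · omega
  · omega
  · omega
  · omega
  · intro k hk hk'
    have := H.small k hk
    simp only [Function.update_apply]
    split_ifs <;> grind
  · intro k hk hk'
    simp only [Function.update_apply]
    split_ifs with h h'
    · omega
    · exact H.medl _ (by omega) (by omega)
    · omega
    · omega
    · exact H.medl _ (by omega) (by omega)
  · intro k hk hk'
    simp only [Function.update_apply]
    rw [if_neg (by omega), if_neg (by omega), if_neg (by omega), if_neg (by omega)]
    exact H.rest _ (by omega) (by omega)
  · intro k hk hk'
    simp only [Function.update_apply]
    split_ifs with h h'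
    · exact H.medr _ (by omega) (by omega)
    · omega
    · omega
    · omega
    · exact H.medr _ (by omega) (by omega)
  · intro k hk hk'
    have := H.large k
    simp only [Function.update_apply]
    split_ifs <;> grind
  -- The effect is that of swapping the keys at `a` and `b` and then moving the small key left and
  -- the large key right by the two 3-cycles.
  · refine exists_perm_comp H.perm (Equiv.swap a b * (Equiv.swap s.i₁ a * Equiv.swap (s.i₁ + 1) a *
      (Equiv.swap s.j₁ b * Equiv.swap (s.j₁ - 1) b))) ?_ ?_
    · intro k hk
      simp only [Equiv.Perm.mul_apply, Equiv.swap_apply_def]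
      grind
    · intro k
      simp only [Equiv.Perm.mul_apply, State.filled, harr, hi₁, hj₁, Function.update_apply]
      simp only [Equiv.swap_apply_def]
      grind
  · rw [card_filter_Ioo_succ _ (by omega), ← H.exch, if_pos (by omega)]
  · rw [card_filter_Ioo_succ _ (by omega), if_pos (by omega)]
    have := H.left
    push_cast
    omega
  · have := H.comps
    simp only [State.exchange, State.write, State.countSwaps]
    push_cast
    omega
  · have := H.swaps
    simp only [State.exchange, State.write, State.countSwaps]
    push_cast
    omega

theorem countComp (H : Inv A l r p q c w s a b x) : Inv A l r p q (c + 1) w s.countComp a b x :=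
  { H with
    comps := by
      have := H.comps
      simp only [State.countComp]
      push_cast
      omega }

theorem setI (H : Inv A l r p q c w s a b x) (k : ℤ) :
    Inv A l r p q c w { s with i := k } a b x :=
  { H with }

theorem setJ (H : Inv A l r p q c w s a b x) (k : ℤ) :
    Inv A l r p q c w { s with j := k } a b x :=
  { H with }

end Inv

/-! ### The scans and the outer loop. -/

/-- The map `h` of keys does not change the outcome of comparisons with the pivots `p` and `q`. -/
def PreservesClasses (h : ℕ → ℕ) (p q : ℕ) : Prop :=
  ∀ x, (h x < p ↔ x < p) ∧ (q < h x ↔ q < x)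

variable {A : ℤ → ℕ} {l r : ℤ} {p q : ℕ} {c w : ℤ} {s : State} {a b : ℤ} {x : ℕ}

theorem scanUp_stop (h : q < s.arr s.i) : scanUp p q s = some (false, s.countComp) := by
  rw [scanUp, if_neg (not_le.2 h)]

theorem scanUp_cross (h : s.arr s.i ≤ q) (hij : s.j ≤ s.i) :
    scanUp p q s = some (true, s.countComp) := by
  rw [scanUp, if_pos h]
  exact if_pos hij

theorem scanUp_move (h : s.arr s.i ≤ q) (h' : s.arr s.i < p) (hij : s.i < s.j) :
    scanUp p q s = scanUp p q { s.countComp.countComp.moveSmall with i := s.i + 1 } := by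
  rw [scanUp.eq_def p q s, if_pos h]
  refine (if_neg (not_le.2 hij)).trans ?_
  have key : (if s.countComp.arr s.countComp.i < p then s.countComp.countComp.moveSmall
    else s.countComp.countComp) = s.countComp.countComp.moveSmall := if_pos h'
  rw [key]
  rfl

theorem scanUp_skip (h : s.arr s.i ≤ q) (h' : p ≤ s.arr s.i) (hij : s.i < s.j) :
    scanUp p q s = scanUp p q { s.countComp.countComp with i := s.i + 1 } := by
  rw [scanUp.eq_def p q s, if_pos h]
  refine (if_neg (not_le.2 hij)).trans ?_
  have key : (if s.countComp.arr s.countComp.i < p then s.countComp.countComp.moveSmall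
    else s.countComp.countComp) = s.countComp.countComp := if_neg (not_lt.2 h')
  rw [key]
  rfl

theorem scanDown_stop (h : s.arr s.j < p) : scanDown p q s = some (false, s.countComp) := by
  rw [scanDown, if_neg (not_le.2 h)]

theorem scanDown_move (h : p ≤ s.arr s.j) (h' : q < s.arr s.j) :
    scanDown p q s = if s.j ≤ s.i then some (true, s.countComp.countComp.moveLarge)
      else scanDown p q { s.countComp.countComp.moveLarge with j := s.j - 1 } := by
  rw [scanDown.eq_def p q s, if_pos h]
  have key : (if s.countComp.arr s.countComp.j > q then s.countComp.countComp.moveLarge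
    else s.countComp.countComp) = s.countComp.countComp.moveLarge := if_pos h'
  dsimp only
  rw [key]
  rfl

theorem scanDown_skip (h : p ≤ s.arr s.j) (h' : s.arr s.j ≤ q) (hij : s.i < s.j) :
    scanDown p q s = scanDown p q { s.countComp.countComp with j := s.j - 1 } := by
  rw [scanDown.eq_def p q s, if_pos h]
  have key : (if s.countComp.arr s.countComp.j > q then s.countComp.countComp.moveLarge
    else s.countComp.countComp) = s.countComp.countComp := if_neg (not_lt.2 h')
  dsimp only
  rw [key]
  exact if_neg (not_le.2 hij)

/-- The cell `b + 1` is where `j` stands. The bound `hq` on its content makes a scan that arrives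
there pass the test `A[i] ≤ q` and leave the outer loop. Either way the scan ends with one
comparison that is not yet paid for by a processed key, hence `c + 1`. The last clause says that a
relabelled run takes the same path. -/
theorem scanUp_spec (hpq : p ≤ q) (H : Inv A l r p q c w s a b x) (hi : s.i = a)
    (hj : s.j = b + 1) (hq : s.arr (b + 1) ≤ q) :
    ∃ crossed t a', scanUp p q s = some (crossed, t) ∧ t.i = a' ∧ t.j = b + 1 ∧ a ≤ a' ∧
      Inv A l r p q (c + 1) w t a' b x ∧ (crossed = true → a' = b + 1) ∧
      (crossed = false → a' ≤ b ∧ q < t.arr a') ∧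
      ∀ h s', PreservesClasses h p q → s.Rel h l r s' →
        ∃ t', scanUp p q s' = some (crossed, t') ∧ t.Rel h l r t' := by
  obtain ⟨n, hn⟩ : ∃ n : ℕ, (n : ℤ) = b + 1 - a := ⟨(b + 1 - a).toNat, by have := H.hab; omega⟩
  induction n generalizing s a with
  | zero =>
    have hab : a = b + 1 := by omega
    subst hab
    refine ⟨true, s.countComp, b + 1, scanUp_cross (by rwa [hi]) (by omega), hi, hj, le_rfl,
      H.countComp, fun _ => rfl, by simp, fun h s' hh R => ⟨s'.countComp, ?_, R.countComp⟩⟩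
    have hb : s'.arr (b + 1) = h (s.arr (b + 1)) :=
      R.arr _ (by have := H.hl; have := H.ha; omega) (by have := H.hb; have := H.hr; omega)
    have := (hh (s.arr (b + 1))).2
    exact scanUp_cross (by rw [R.i, hi]; omega) (by rw [R.i, R.j]; omega)
  | succ n ih =>
    have hab : a ≤ b := by omega
    have Ha := H.ha
    have Hb := H.hb
    have Hl := H.hl
    have Hr := H.hr
    have harr : ∀ {h s'}, s.Rel h l r s' → s'.arr s'.i = h (s.arr s.i) := fun R => by
      rw [R.i]
      exact R.arr _ (by omega) (by omega)
    rcases le_or_gt (s.arr s.i) q with h1 | h1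
    · rcases lt_or_ge (s.arr s.i) p with h2 | h2
      · have H' := (H.moveSmall hab hi (hi ▸ h2) hpq).setI (s.i + 1)
        have hq' : s.countComp.countComp.moveSmall.arr (b + 1) ≤ q := by
          rw [State.moveSmall_arr]
          change Function.update (Function.update s.arr s.i₁ _) s.i _ (b + 1) ≤ q
          rw [Function.update_of_ne (by omega), Function.update_of_ne (by omega)]
          exact hq
        obtain ⟨cr, t, a', e, hi', hj', haa, Ht, hc1, hc2, hR⟩ :=
          ih H' (congrArg (· + 1) hi) hj hq' (by omega)
        refine ⟨cr, t, a', (scanUp_move h1 h2 (by omega)).trans e, hi', hj', by omega, Ht, hc1,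
          hc2, fun h s' hh R => ?_⟩
        have R' : (s.countComp.countComp.moveSmall).Rel h l r s'.countComp.countComp.moveSmall :=
          R.countComp.countComp.moveSmall Hl (by rw [← hi] at Ha; exact Ha)
            (by change s.i ≤ r; omega)
        obtain ⟨t', e', Rt⟩ := hR h _ hh (R'.setI (congrArg (· + 1) R.i))
        have := harr R
        have := hh (s.arr s.i)
        exact ⟨t', (scanUp_move (by omega) (by omega) (by rw [R.i, R.j]; omega)).trans e', Rt⟩
      · have H' := (H.medium hab (hi ▸ h2) (hi ▸ h1)).setI (s.i + 1)
        obtain ⟨cr, t, a', e, hi', hj', haa, Ht, hc1, hc2, hR⟩ :=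
          ih H' (congrArg (· + 1) hi) hj hq (by omega)
        refine ⟨cr, t, a', (scanUp_skip h1 h2 (by omega)).trans e, hi', hj', by omega, Ht, hc1,
          hc2, fun h s' hh R => ?_⟩
        obtain ⟨t', e', Rt⟩ := hR h _ hh (R.countComp.countComp.setI (congrArg (· + 1) R.i))
        have := harr R
        have := hh (s.arr s.i)
        exact ⟨t', (scanUp_skip (by omega) (by omega) (by rw [R.i, R.j]; omega)).trans e', Rt⟩
    · refine ⟨false, s.countComp, a, scanUp_stop h1, hi, hj, le_rfl, H.countComp, by simp,
        fun _ => ⟨hab, hi ▸ h1⟩, fun h s' hh R => ⟨s'.countComp, scanUp_stop ?_, R.countComp⟩⟩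
      have := harr R
      have := hh (s.arr s.i)
      omega

/-- The large key at `a`, where `i` waits, is a sentinel: the scan can only cross there, after
moving that key to the large ones. The key is then processed by `j` at the full price of two
comparisons, so the offset does not grow; the comparison with which `i` stopped at it remains as the
extra one. -/
theorem scanDown_spec (hpq : p ≤ q) (H : Inv A l r p q c w s a b x) (hi : s.i = a)
    (hj : s.j = b) (hab : a ≤ b) (hq : q < s.arr a) :
    ∃ crossed t b', scanDown p q s = some (crossed, t) ∧ t.i = a ∧ b' ≤ b ∧
      (crossed = true → Inv A l r p q c w t a b' x ∧ b' = a - 1) ∧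
      (crossed = false → Inv A l r p q (c + 1) w t a b' x ∧ t.j = b' ∧ a < b' ∧ q < t.arr a ∧
        t.arr b' < p) ∧
      ∀ h s', PreservesClasses h p q → s.Rel h l r s' →
        ∃ t', scanDown p q s' = some (crossed, t') ∧ t.Rel h l r t' := by
  obtain ⟨n, hn⟩ : ∃ n : ℕ, (n : ℤ) = b - a := ⟨(b - a).toNat, by omega⟩
  induction n generalizing s b with
  | zero =>
    have hab : b = a := by omega
    subst hab
    have Ha := H.ha
    have Hb := H.hb
    have Hl := H.hl
    have Hr := H.hr
    refine ⟨true, s.countComp.countComp.moveLarge, b - 1, ?_, hi, by omega,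
      fun _ => ⟨H.moveLarge hab hj hq, rfl⟩, by simp, fun h s' hh R =>
      ⟨s'.countComp.countComp.moveLarge, ?_, R.countComp.countComp.moveLarge Hr
        (by rw [← hj] at Hb; exact Hb) (by change l ≤ s.j; omega)⟩⟩
    · rw [scanDown_move (by rw [hj]; omega) (by rwa [hj]), if_pos (by omega)]
    · have hb : s'.arr b = h (s.arr b) := R.arr _ (by omega) (by omega)
      have := hh (s.arr b)
      rw [scanDown_move (by rw [R.j, hj]; omega) (by rw [R.j, hj]; omega),
        if_pos (by rw [R.i, R.j]; omega)]
  | succ n ih =>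
    have Ha := H.ha
    have Hb := H.hb
    have Hl := H.hl
    have Hr := H.hr
    have harr : ∀ {h s'}, s.Rel h l r s' → s'.arr s'.j = h (s.arr s.j) := fun R => by
      rw [R.j]
      exact R.arr _ (by omega) (by omega)
    rcases le_or_gt p (s.arr s.j) with h1 | h1
    · rcases lt_or_ge q (s.arr s.j) with h2 | h2
      · have H' := (H.moveLarge hab hj (hj ▸ h2)).setJ (s.j - 1)
        have hq' : q < s.countComp.countComp.moveLarge.arr a := by
          rw [State.moveLarge_arr]
          change q < Function.update (Function.update s.arr s.j₁ _) s.j _ a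
          rw [Function.update_of_ne (by omega), Function.update_of_ne (by omega)]
          exact hq
        obtain ⟨cr, t, b', e, hi', hbb, hc1, hc2, hR⟩ :=
          ih H' hi (congrArg (· - 1) hj) (by omega) hq' (by omega)
        refine ⟨cr, t, b', ?_, hi', by omega, hc1, hc2, fun h s' hh R => ?_⟩
        · rw [scanDown_move h1 h2, if_neg (by omega), e]
        · have R' : (s.countComp.countComp.moveLarge).Rel h l r s'.countComp.countComp.moveLarge :=
            R.countComp.countComp.moveLarge Hr (by rw [← hj] at Hb; exact Hb)
              (by change l ≤ s.j; omega)
          obtain ⟨t', e', Rt⟩ := hR h _ hh (R'.setJ (congrArg (· - 1) R.j))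
          refine ⟨t', ?_, Rt⟩
          have := harr R
          have := hh (s.arr s.j)
          rw [scanDown_move (by omega) (by omega), if_neg (by rw [R.i, R.j]; omega), e']
      · have H' := (H.medium' hab (hj ▸ h1) (hj ▸ h2)).setJ (s.j - 1)
        obtain ⟨cr, t, b', e, hi', hbb, hc1, hc2, hR⟩ :=
          ih H' hi (congrArg (· - 1) hj) (by omega) hq (by omega)
        refine ⟨cr, t, b', (scanDown_skip h1 h2 (by omega)).trans e, hi', by omega, hc1, hc2,
          fun h s' hh R => ?_⟩
        obtain ⟨t', e', Rt⟩ := hR h _ hh (R.countComp.countComp.setJ (congrArg (· - 1) R.j))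
        have := harr R
        have := hh (s.arr s.j)
        exact ⟨t', (scanDown_skip (by omega) (by omega) (by rw [R.i, R.j]; omega)).trans e', Rt⟩
    · refine ⟨false, s.countComp, b, scanDown_stop h1, hi, le_rfl, by simp,
        fun _ => ⟨H.countComp, hj, by omega, hq, hj ▸ h1⟩,
        fun h s' hh R => ⟨s'.countComp, scanDown_stop ?_, R.countComp⟩⟩
      have := harr R
      have := hh (s.arr s.j)
      omega

/-- The outer loop terminates; at its end all keys have been looked at. -/
theorem outerLoop_spec (hpq : p ≤ q) (H : Inv A l r p q c w s a b x) (hi : s.i + 1 = a)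
    (hj : s.j = b + 1) (hq : s.arr (b + 1) ≤ q) :
    ∃ t a' x', outerLoop p q s = some t ∧ Inv A l r p q (c + 1) w t a' (a' - 1) x' ∧
      ∀ h s', PreservesClasses h p q → s.Rel h l r s' →
        ∃ t', outerLoop p q s' = some t' ∧ t.Rel h l r t' := by
  obtain ⟨n, hn⟩ : ∃ n : ℕ, (b + 1 - a) ≤ n := ⟨(b + 1 - a).toNat, by omega⟩
  induction n using Nat.strong_induction_on generalizing s a b x with
  | _ n ih =>
  obtain ⟨cr, t, a', e, hti, htj, haa, Ht, hc1, hc2, hR⟩ := scanUp_spec hpq (H.setI a) rfl hj hq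
  cases cr with
  | true =>
    refine ⟨t, a', x, ?_, ?_, ?_⟩
    · rw [outerLoop, hi, e]
      rfl
    · have : b = a' - 1 := by rw [hc1 rfl]; ring
      rw [← this]
      exact Ht
    · intro h s' hh R
      obtain ⟨t', e', R'⟩ := hR h _ hh (R.setI (k := a) rfl)
      refine ⟨t', ?_, R'⟩
      rw [outerLoop, R.i, hi, e']
      rfl
  | false =>
    obtain ⟨hab, hqa⟩ := hc2 rfl
    obtain ⟨cr2, u, b', e2, hui, hbb, hd1, hd2, hR2⟩ := scanDown_spec hpq (Ht.setJ b) hti rfl hab hqa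
    have htj' : t.j - 1 = b := by omega
    cases cr2 with
    | true =>
      obtain ⟨Hu, rfl⟩ := hd1 rfl
      refine ⟨u, a', x, ?_, Hu, ?_⟩
      · rw [outerLoop, hi, e]
        simp [htj', e2]
      · intro h s' hh R
        obtain ⟨t', e', R'⟩ := hR h _ hh (R.setI (k := a) rfl)
        obtain ⟨u', e2', R2'⟩ := hR2 h _ hh (R'.setJ (k := b) rfl)
        refine ⟨u', ?_, R2'⟩
        rw [outerLoop, R.i, hi, e']
        simp [R'.j, htj', e2']
    | false =>
      obtain ⟨Hu, huj, hab', hqa', hpb⟩ := hd2 rfl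
      have Ha := Hu.ha
      have Hb := Hu.hb
      have Hl := Hu.hl
      have Hr := Hu.hr
      have Hx := Hu.exchange hab' hui huj hqa' hpb
      -- A full round of the outer loop restores the offset, so only its last round contributes an
      -- extra comparison.
      rw [show c + 1 + 1 - 2 = c by ring] at Hx
      have hq' : u.exchange.arr (b' - 1 + 1) ≤ q := by
        rw [State.exchange_arr _ (by omega) (by omega) (by omega), sub_add_cancel, huj, hui]
        rw [Function.update_self]
        -- The cell under `j` now holds the former content of `j₁ - 1`: either the small key of `b'`
        -- itself, left in the new hole, or a medium key.
        rcases eq_or_ne (u.j₁ - 1) b' with h | h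
        · rw [h]
          omega
        · exact (Hu.medr _ (by omega) (by omega)).2
      obtain ⟨v, a'', x', e3, Hv, hR3⟩ := ih (n - 2) (by have := Hu.hab; omega) Hx
        (by change u.i + 1 = _; omega) (by change u.j = _; omega) hq' (by omega)
      refine ⟨v, a'', x', ?_, ?_, ?_⟩
      · rw [outerLoop, hi, e]
        simp [htj', e2, e3]
      · exact Hv
      · intro h s' hh R
        obtain ⟨t', e', R'⟩ := hR h _ hh (R.setI (k := a) rfl)
        obtain ⟨u', e2', R2'⟩ := hR2 h _ hh (R'.setJ (k := b) rfl)
        obtain ⟨v', e3', R3'⟩ := hR3 h _ hh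
          (R2'.exchange Hl (by omega) (by omega) (by omega) Hr)
        refine ⟨v', ?_, R3'⟩
        rw [outerLoop, R.i, hi, e']
        simp [R'.j, htj', e2', e3']

/-! ### Correctness and exact cost of a partitioning step. -/

/-- What the partitioning step on the range `l, …, r` with pivots `p < q` achieves: `s` is the
final state if the step is started in the memory `m`, the number of exchanges is `x`, and the
pointer `i` has passed exactly the keys in the positions `l + 1, …, a - 1`, up to a key which was
moved by `j`. -/
structure Partitioned (m : Mem) (l r : ℤ) (p q : ℕ) (s : State) (a : ℤ) (x : ℕ) : Prop where
  hl : l ≤ s.i₁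
  hij : s.i₁ < s.j₁
  hr : s.j₁ ≤ r
  small : ∀ k, l ≤ k → k < s.i₁ → s.arr k < p
  arr_i₁ : s.arr s.i₁ = p
  medium : ∀ k, s.i₁ < k → k < s.j₁ → p < s.arr k ∧ s.arr k < q
  arr_j₁ : s.arr s.j₁ = q
  large : ∀ k, s.j₁ < k → k ≤ r → q < s.arr k
  perm : ∃ σ : Equiv.Perm ℤ, (∀ k, ¬ (l ≤ k ∧ k ≤ r) → σ k = k) ∧ ∀ k, s.arr k = m.arr (σ k)
  hla : l < a
  har : a ≤ r
  exch : x = #{k ∈ Ioo l a | q < m.arr k}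
  left : s.i₁ - l = #{k ∈ Ioo l a | m.arr k < p ∨ q < m.arr k}
  comps : (s.comps : ℤ) = m.comps + 2 * (r - l) - 2 * x
  swaps : (s.swaps : ℤ) = m.swaps + (if m.arr r < m.arr l then 1 else 0) + 2 + (s.i₁ - l) +
    (r - s.j₁)

/-- The state in which the outer loop is entered. -/
def startState (m : Mem) (l r : ℤ) : State :=
  let s : State := { m with i := l, i₁ := l, j := r, j₁ := r }
  if m.arr l > m.arr r then s.countComp.countSwaps 1 else s.countComp

theorem partitionStep_eq (m : Mem) (l r : ℤ) {p q : ℕ} (hp : p = min (m.arr l) (m.arr r))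
    (hq : q = max (m.arr l) (m.arr r)) :
    partitionStep m l r = (outerLoop p q (startState m l r)).map fun s =>
      ((s.write s.i₁ p).write s.j₁ q).countSwaps 2 := by
  have hp' : p = if m.arr l > m.arr r then m.arr r else m.arr l := by
    rw [hp]; split_ifs <;> omega
  have hq' : q = if m.arr l > m.arr r then m.arr l else m.arr r := by
    rw [hq]; split_ifs <;> omega
  unfold partitionStep
  dsimp only
  rw [← hp', ← hq']
  change (outerLoop p q (startState m l r)).bind _ = _
  cases outerLoop p q (startState m l r) <;> rfl

theorem startState_arr (m : Mem) (l r : ℤ) : (startState m l r).arr = m.arr := by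
  unfold startState
  dsimp only
  split_ifs <;> rfl

theorem startState_i (m : Mem) (l r : ℤ) : (startState m l r).i = l := by
  unfold startState
  dsimp only
  split_ifs <;> rfl

theorem startState_i₁ (m : Mem) (l r : ℤ) : (startState m l r).i₁ = l := by
  unfold startState
  dsimp only
  split_ifs <;> rfl

theorem startState_j (m : Mem) (l r : ℤ) : (startState m l r).j = r := by
  unfold startState
  dsimp only
  split_ifs <;> rfl

theorem startState_j₁ (m : Mem) (l r : ℤ) : (startState m l r).j₁ = r := by
  unfold startState
  dsimp only
  split_ifs <;> rfl

theorem startState_comps (m : Mem) (l r : ℤ) : (startState m l r).comps = m.comps + 1 := by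
  unfold startState
  dsimp only
  split_ifs <;> rfl

theorem startState_swaps (m : Mem) (l r : ℤ) :
    (startState m l r).swaps = m.swaps + if m.arr r < m.arr l then 1 else 0 := by
  unfold startState
  dsimp only
  split_ifs <;> rfl

theorem startState_inv (m : Mem) {l r : ℤ} (hlr : l < r) {p q : ℕ}
    (hp : p = min (m.arr l) (m.arr r)) (hq : q = max (m.arr l) (m.arr r)) :
    Inv m.arr l r p q (m.comps + 1) (m.swaps + if m.arr r < m.arr l then 1 else 0)
      (startState m l r) (l + 1) (r - 1) 0 := by
  refine ⟨?_, ?_, ?_, ?_, ?_, ?_, ?_, ?_, ?_, ?_, ?_, ?_, ?_, ?_, ?_⟩ <;>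
    (try simp only [startState_arr, startState_i₁, startState_j₁, startState_comps,
      startState_swaps])
  · omega
  · omega
  · omega
  · omega
  · omega
  · intros; omega
  · intros; omega
  · intros; trivial
  · intros; omega
  · intros; omega
  -- The program exchanges only the variables `p` and `q`, not the cells; the array with filled
  -- holes is therefore the input with its end keys in increasing order.
  · by_cases h : m.arr r < m.arr l
    · refine ⟨Equiv.swap l r, ?_, ?_⟩
      · intro k hk
        rw [Equiv.swap_apply_of_ne_of_ne] <;> rintro rfl <;> omega
      · intro k
        simp only [State.filled, startState_arr, startState_i₁, startState_j₁,
          Function.update_apply, Equiv.swap_apply_def]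
        grind
    · refine ⟨1, by simp, ?_⟩
      intro k
      simp only [State.filled, startState_arr, startState_i₁, startState_j₁,
          Function.update_apply, Equiv.Perm.one_apply]
      grind
  · rw [show Ioo l (l + 1) = ∅ by ext; simp]
    rfl
  · rw [show Ioo l (l + 1) = ∅ by ext; simp]
    simp
  · push_cast
    ring
  · push_cast
    ring

/-- The number of comparisons is one for the pivots, `2(r - l - 1) - 2x` for the other keys, and one
for the end of the outer loop. In the relabelling clause `h` must fix the pivots, since they are
written back as `p` and `q`. -/
theorem partitionStep_spec (m : Mem) {l r : ℤ} (hlr : l < r)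
    (hinj : Set.InjOn m.arr (Set.Icc l r)) {p q : ℕ}
    (hp : p = min (m.arr l) (m.arr r)) (hq : q = max (m.arr l) (m.arr r)) :
    ∃ s a x, partitionStep m l r = some s ∧ Partitioned m l r p q s a x ∧
      ∀ h m', PreservesClasses h p q → h p = p → h q = q →
        (∀ k, l ≤ k → k ≤ r → m'.arr k = h (m.arr k)) →
        ∃ s', partitionStep m' l r = some s' ∧ s.Rel h l r s' := by
  have hpq : p ≤ q := by omega
  have hs := startState_inv m hlr hp hq
  obtain ⟨t, a, x, e, H, hR⟩ := outerLoop_spec hpq hs (by rw [startState_i])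
    (by rw [startState_j]; ring) (by rw [sub_add_cancel, startState_arr]; omega)
  have Ha := H.ha
  have Hb := H.hb
  have Hl := H.hl
  have Hr := H.hr
  have harr : (((t.write t.i₁ p).write t.j₁ q).countSwaps 2).arr = t.filled p q := rfl
  have hi₁ : (((t.write t.i₁ p).write t.j₁ q).countSwaps 2).i₁ = t.i₁ := rfl
  have hj₁ : (((t.write t.i₁ p).write t.j₁ q).countSwaps 2).j₁ = t.j₁ := rfl
  have hf1 : t.filled p q t.i₁ = p := by
    rw [State.filled, Function.update_of_ne (by omega), Function.update_self]
  have hf2 : t.filled p q t.j₁ = q := by rw [State.filled, Function.update_self]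
  have hf3 : ∀ k, k ≠ t.i₁ → k ≠ t.j₁ → t.filled p q k = t.arr k := fun k h1 h2 => by
    rw [State.filled, Function.update_of_ne h2, Function.update_of_ne h1]
  -- Distinctness of the keys turns the weak inequalities of the invariant for the medium keys into
  -- strict ones.
  have hfinj : ∀ k k', l ≤ k → k ≤ r → l ≤ k' → k' ≤ r → t.filled p q k = t.filled p q k' →
      k = k' := by
    obtain ⟨σ, hσ, hf⟩ := H.perm
    have hσ' : ∀ k, l ≤ k → k ≤ r → l ≤ σ k ∧ σ k ≤ r := fun k h1 h2 => by
      by_contra hc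
      have := σ.injective (hσ _ hc)
      rw [this] at hc
      exact hc ⟨h1, h2⟩
    intro k k' h1 h2 h3 h4 hk
    rw [hf, hf] at hk
    exact σ.injective (hinj (hσ' k h1 h2) (hσ' k' h3 h4) hk)
  refine ⟨((t.write t.i₁ p).write t.j₁ q).countSwaps 2, a, x, ?_, ?_, ?_⟩
  · rw [partitionStep_eq m l r hp hq, e]
    rfl
  · refine ⟨?_, ?_, ?_, ?_, ?_, ?_, ?_, ?_, ?_, ?_, ?_, H.exch, ?_, ?_, ?_⟩ <;>
      (try simp only [harr, hi₁, hj₁])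
    · exact Hl
    · omega
    · exact Hr
    · intro k hk hk'
      rw [hf3 _ (by omega) (by omega)]
      exact H.small k hk hk'
    · exact hf1
    · intro k hk hk'
      have h1 : k ≠ t.i₁ := by omega
      have h2 : k ≠ t.j₁ := by omega
      have h3 : p ≤ t.arr k ∧ t.arr k ≤ q := by
        rcases lt_or_ge k a with h | h
        · exact H.medl k hk h
        · exact H.medr k (by omega) hk'
      have h4 : t.filled p q k ≠ p := fun h =>
        h1 (hfinj k t.i₁ (by omega) (by omega) (by omega) (by omega) (h.trans hf1.symm))
      have h5 : t.filled p q k ≠ q := fun h =>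
        h2 (hfinj k t.j₁ (by omega) (by omega) (by omega) (by omega) (h.trans hf2.symm))
      rw [hf3 _ h1 h2] at *
      omega
    · exact hf2
    · intro k hk hk'
      rw [hf3 _ (by omega) (by omega)]
      exact H.large k hk hk'
    · exact H.perm
    · omega
    · omega
    · exact H.left
    · have := H.comps
      change (t.comps : ℤ) = _
      omega
    · have := H.swaps
      change ((t.swaps + 2 : ℕ) : ℤ) = _
      push_cast
      omega
  · intro h m' hh hhp hhq hm
    have hm1 : m'.arr l = m.arr l := by
      rw [hm l le_rfl hlr.le]
      rcases le_total (m.arr l) (m.arr r) with h' | h'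
      · rw [min_eq_left h'] at hp
        rw [← hp, hhp]
      · rw [max_eq_left h'] at hq
        rw [← hq, hhq]
    have hm2 : m'.arr r = m.arr r := by
      rw [hm r hlr.le le_rfl]
      rcases le_total (m.arr l) (m.arr r) with h' | h'
      · rw [max_eq_right h'] at hq
        rw [← hq, hhq]
      · rw [min_eq_right h'] at hp
        rw [← hp, hhp]
    obtain ⟨t', e', R⟩ := hR h (startState m' l r) hh
      ⟨by rw [startState_i, startState_i], by rw [startState_i₁, startState_i₁],
        by rw [startState_j, startState_j], by rw [startState_j₁, startState_j₁],
        by simpa only [startState_arr] using hm⟩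
    refine ⟨((t'.write t'.i₁ p).write t'.j₁ q).countSwaps 2, ?_, ?_⟩
    · rw [partitionStep_eq m' l r (hp.trans (by rw [hm1, hm2])) (hq.trans (by rw [hm1, hm2])), e']
      rfl
    · refine ⟨R.i, R.i₁, R.j, R.j₁, fun k hk hk' => ?_⟩
      rw [harr]
      change t'.filled p q k = _
      simp only [State.filled, Function.update_apply, R.i₁, R.j₁]
      split_ifs
      · exact hhq.symm
      · exact hhp.symm
      · exact R.arr k hk hk'

namespace Partitioned

variable {m : Mem} {l r : ℤ} {p q : ℕ} {s : State} {a : ℤ} {x : ℕ}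

theorem perm_mem (H : Partitioned m l r p q s a x) : ∃ σ : Equiv.Perm ℤ,
    (∀ k, ¬ (l ≤ k ∧ k ≤ r) → σ k = k) ∧ (∀ k, l ≤ k → k ≤ r → l ≤ σ k ∧ σ k ≤ r) ∧
    ∀ k, s.arr k = m.arr (σ k) := by
  obtain ⟨σ, hσ, hf⟩ := H.perm
  refine ⟨σ, hσ, fun k h1 h2 => ?_, hf⟩
  by_contra hc
  have := σ.injective (hσ _ hc)
  rw [this] at hc
  exact hc ⟨h1, h2⟩

theorem injOn (H : Partitioned m l r p q s a x) (hinj : Set.InjOn m.arr (Set.Icc l r)) :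
    Set.InjOn s.arr (Set.Icc l r) := by
  obtain ⟨σ, -, hσ, hf⟩ := H.perm_mem
  intro k hk k' hk' h
  rw [hf, hf] at h
  exact σ.injective (hinj (hσ k hk.1 hk.2) (hσ k' hk'.1 hk'.2) h)

theorem arr_of_notMem (H : Partitioned m l r p q s a x) {k : ℤ} (hk : ¬ (l ≤ k ∧ k ≤ r)) :
    s.arr k = m.arr k := by
  obtain ⟨σ, hσ, hf⟩ := H.perm
  rw [hf, hσ k hk]

end Partitioned

/-! ### Termination, and splitting a sort into its three recursive calls. -/

/-- The program terminates and changes only cells in its range. -/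
theorem quicksort_frame (m : Mem) (l r : ℤ) (hinj : Set.InjOn m.arr (Set.Icc l r)) :
    ∃ m', quicksort m l r = some m' ∧ ∀ k, ¬ (l ≤ k ∧ k ≤ r) → m'.arr k = m.arr k := by
  obtain ⟨n, hn⟩ : ∃ n : ℕ, r - l ≤ n := ⟨(r - l).toNat, by omega⟩
  induction n using Nat.strong_induction_on generalizing m l r with
  | _ n ih =>
  rw [quicksort]
  by_cases hlr : r - l ≥ 1
  · obtain ⟨s, a, x, e, H, -⟩ := partitionStep_spec m (l := l) (r := r) (by omega) hinj rfl rfl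
    have h1 := H.hl
    have h2 := H.hij
    have h3 := H.hr
    have hs := H.injOn hinj
    obtain ⟨m1, e1, f1⟩ := ih (n - 1) (by omega) s.toMem l (s.i₁ - 1)
      (hs.mono (Set.Icc_subset_Icc le_rfl (by omega))) (by omega)
    obtain ⟨m2, e2, f2⟩ := ih (n - 1) (by omega) m1 (s.i₁ + 1) (s.j₁ - 1) (by
      intro k hk k' hk' h
      simp only [Set.mem_Icc] at hk hk'
      rw [f1 k (by omega), f1 k' (by omega)] at h
      exact hs ⟨by omega, by omega⟩ ⟨by omega, by omega⟩ h) (by omega)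
    obtain ⟨m3, e3, f3⟩ := ih (n - 1) (by omega) m2 (s.j₁ + 1) r (by
      intro k hk k' hk' h
      simp only [Set.mem_Icc] at hk hk'
      rw [f2 k (by omega), f2 k' (by omega), f1 k (by omega), f1 k' (by omega)] at h
      exact hs ⟨by omega, by omega⟩ ⟨by omega, by omega⟩ h) (by omega)
    refine ⟨m3, ?_, fun k hk => ?_⟩
    · rw [if_pos hlr, e]
      change (quicksort s.toMem l (s.i₁ - 1)).bind _ = _
      rw [e1]
      change (quicksort m1 (s.i₁ + 1) (s.j₁ - 1)).bind _ = _
      rw [e2]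
      exact e3
    · rw [f3 k (by omega), f2 k (by omega), f1 k (by omega), H.arr_of_notMem hk]
  · exact ⟨m, if_neg hlr, fun _ _ => rfl⟩

/-- The memory after sorting the range `l, …, r`. -/
noncomputable def sorted (m : Mem) (l r : ℤ) : Mem := (quicksort m l r).getD m

theorem quicksort_eq_some {m : Mem} {l r : ℤ} (hinj : Set.InjOn m.arr (Set.Icc l r)) :
    quicksort m l r = some (sorted m l r) := by
  obtain ⟨m', e, -⟩ := quicksort_frame m l r hinj
  rw [sorted, e]
  rfl

theorem sorted_arr_of_notMem {m : Mem} {l r : ℤ} (hinj : Set.InjOn m.arr (Set.Icc l r)) {k : ℤ}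
    (hk : ¬ (l ≤ k ∧ k ≤ r)) : (sorted m l r).arr k = m.arr k := by
  obtain ⟨m', e, h⟩ := quicksort_frame m l r hinj
  rw [sorted, e]
  exact h k hk

theorem sorted_of_le {m : Mem} {l r : ℤ} (h : r ≤ l) : sorted m l r = m := by
  rw [sorted, quicksort, if_neg (by omega)]
  rfl

/-- The last two clauses let the second and third call be analysed as if they started right after
the partitioning step: the earlier calls do not touch their cells. -/
theorem sorted_eq {m : Mem} {l r : ℤ} (hlr : l < r) {p q : ℕ} {s : State} {a : ℤ} {x : ℕ}
    (hinj : Set.InjOn m.arr (Set.Icc l r)) (e : partitionStep m l r = some s)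
    (H : Partitioned m l r p q s a x) :
    sorted m l r = sorted (sorted (sorted s.toMem l (s.i₁ - 1)) (s.i₁ + 1) (s.j₁ - 1))
      (s.j₁ + 1) r ∧
    (∀ k, s.i₁ ≤ k → (sorted s.toMem l (s.i₁ - 1)).arr k = s.arr k) ∧
    (∀ k, s.j₁ ≤ k → (sorted (sorted s.toMem l (s.i₁ - 1)) (s.i₁ + 1) (s.j₁ - 1)).arr k =
      s.arr k) := by
  have h1 := H.hl
  have h2 := H.hij
  have h3 := H.hr
  have hs := H.injOn hinj
  have i1 : Set.InjOn s.arr (Set.Icc l (s.i₁ - 1)) :=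
    hs.mono (Set.Icc_subset_Icc le_rfl (by omega))
  have f1 : ∀ k, s.i₁ ≤ k → (sorted s.toMem l (s.i₁ - 1)).arr k = s.arr k := fun k hk =>
    sorted_arr_of_notMem i1 (by omega)
  have i2 : Set.InjOn (sorted s.toMem l (s.i₁ - 1)).arr (Set.Icc (s.i₁ + 1) (s.j₁ - 1)) := by
    intro k hk k' hk' h
    simp only [Set.mem_Icc] at hk hk'
    rw [f1 k (by omega), f1 k' (by omega)] at h
    exact hs ⟨by omega, by omega⟩ ⟨by omega, by omega⟩ h
  have f2 : ∀ k, s.j₁ ≤ k →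
      (sorted (sorted s.toMem l (s.i₁ - 1)) (s.i₁ + 1) (s.j₁ - 1)).arr k = s.arr k := fun k hk => by
    rw [sorted_arr_of_notMem i2 (by omega), f1 k (by omega)]
  have i3 : Set.InjOn (sorted (sorted s.toMem l (s.i₁ - 1)) (s.i₁ + 1) (s.j₁ - 1)).arr
      (Set.Icc (s.j₁ + 1) r) := by
    intro k hk k' hk' h
    simp only [Set.mem_Icc] at hk hk'
    rw [f2 k (by omega), f2 k' (by omega)] at h
    exact hs ⟨by omega, by omega⟩ ⟨by omega, by omega⟩ h
  refine ⟨?_, f1, f2⟩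
  rw [sorted.eq_def m, quicksort, if_pos (by omega), e]
  change ((quicksort s.toMem l (s.i₁ - 1)).bind _).getD m = _
  rw [quicksort_eq_some i1]
  change ((quicksort _ (s.i₁ + 1) (s.j₁ - 1)).bind _).getD m = _
  rw [quicksort_eq_some i2]
  change (quicksort _ (s.j₁ + 1) r).getD m = _
  rw [quicksort_eq_some i3]
  rfl

/-! ### Averages over permutations of a finite set of keys, and sums over ranks. -/

theorem mem_permsOfFinset {V : Finset ℕ} {g : Equiv.Perm ℕ} :
    g ∈ permsOfFinset V ↔ ∀ x, x ∉ V → g x = x := by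
  rw [mem_perms_of_finset_iff]
  exact ⟨fun h x hx => by_contra fun hc => hx (h hc), fun h x hx => by_contra fun hc => hx (h x hc)⟩

theorem apply_mem {V : Finset ℕ} {g : Equiv.Perm ℕ} (hg : g ∈ permsOfFinset V) {x : ℕ}
    (hx : x ∈ V) : g x ∈ V := by
  by_contra hc
  rw [mem_permsOfFinset] at hg
  rw [g.injective (hg _ hc)] at hc
  exact hc hx

theorem mul_mem_perms {V : Finset ℕ} {g h : Equiv.Perm ℕ} (hg : g ∈ permsOfFinset V)
    (hh : h ∈ permsOfFinset V) : g * h ∈ permsOfFinset V := by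
  rw [mem_permsOfFinset] at *
  intro x hx
  rw [Equiv.Perm.mul_apply, hh x hx, hg x hx]

theorem inv_mem_perms {V : Finset ℕ} {g : Equiv.Perm ℕ} (hg : g ∈ permsOfFinset V) :
    g⁻¹ ∈ permsOfFinset V := by
  rw [mem_permsOfFinset] at *
  intro x hx
  rw [Equiv.Perm.inv_eq_iff_eq, hg x hx]

theorem perms_mono {V W : Finset ℕ} (h : W ⊆ V) : permsOfFinset W ⊆ permsOfFinset V := by
  intro g hg
  rw [mem_permsOfFinset] at *
  exact fun x hx => hg x fun hc => hx (h hc)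

theorem swap_mem_perms {V : Finset ℕ} {x y : ℕ} (hx : x ∈ V) (hy : y ∈ V) :
    Equiv.swap x y ∈ permsOfFinset V := by
  rw [mem_permsOfFinset]
  intro z hz
  rw [Equiv.swap_apply_of_ne_of_ne] <;> rintro rfl <;> contradiction

theorem image_perm {V : Finset ℕ} {g : Equiv.Perm ℕ} (hg : g ∈ permsOfFinset V) :
    V.map g.toEmbedding = V :=
  eq_of_subset_of_card_le (fun x hx => by
    obtain ⟨y, hy, rfl⟩ := mem_map.1 hx
    exact apply_mem hg hy) (by rw [card_map])

theorem sum_perm_apply {V : Finset ℕ} {g : Equiv.Perm ℕ} (hg : g ∈ permsOfFinset V) (f : ℕ → ℝ) :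
    ∑ x ∈ V, f (g x) = ∑ x ∈ V, f x := by
  conv_rhs => rw [← image_perm hg, sum_map]
  rfl

/-- Averaging over the permutations of `W`. -/
theorem sum_of_average {Γ : Finset (Equiv.Perm ℕ)} {W : Finset ℕ}
    (hΓ : ∀ h ∈ permsOfFinset W, ∀ g ∈ Γ, h * g ∈ Γ) (X : Equiv.Perm ℕ → ℝ) (c : ℝ)
    (hX : ∀ g ∈ Γ, ∑ h ∈ permsOfFinset W, X (h * g) = (#W).factorial * c) :
    ∑ g ∈ Γ, X g = #Γ * c := by
  have h1 : ∑ g ∈ Γ, ∑ h ∈ permsOfFinset W, X (h * g) = #Γ * ((#W).factorial * c) := by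
    rw [sum_congr rfl hX, sum_const, nsmul_eq_mul]
  -- Left multiplication by `h` permutes `Γ`, so each inner sum equals the full sum over `Γ`.
  have h2 : ∀ h ∈ permsOfFinset W, ∑ g ∈ Γ, X (h * g) = ∑ g ∈ Γ, X g := fun h hh =>
    sum_nbij' (fun g => h * g) (fun g => h⁻¹ * g) (fun g hg => hΓ h hh g hg)
      (fun g hg => hΓ _ (inv_mem_perms hh) g hg) (by simp) (by simp) (by simp)
  rw [sum_comm, sum_congr rfl h2, sum_const, card_perms_of_finset, nsmul_eq_mul] at h1
  have h3 : ((#W).factorial : ℝ) ≠ 0 := by positivity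
  apply mul_left_cancel₀ h3
  rw [h1]
  ring

/-- The permutations of `V` which map `x` to `u` and `y` to `v`. -/
def permsWith (V : Finset ℕ) (x y u v : ℕ) : Finset (Equiv.Perm ℕ) :=
  {g ∈ permsOfFinset V | g x = u ∧ g y = v}

/-- The set is a coset of the group of permutations of `V` without `u` and `v`. The representative
`g0` is built from two transpositions: one brings `x` to `u`, the other brings the image of `y` to
`v`. -/
theorem card_permsWith {V : Finset ℕ} {x y u v : ℕ} (hx : x ∈ V) (hy : y ∈ V) (hxy : x ≠ y)
    (hu : u ∈ V) (hv : v ∈ V) (huv : u ≠ v) :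
    #(permsWith V x y u v) = (#V - 2).factorial := by
  have hg1 := swap_mem_perms hx hu
  set g1 := Equiv.swap x u with hg1_def
  have h1x : g1 x = u := Equiv.swap_apply_left _ _
  have hy' : g1 y ∈ V := apply_mem hg1 hy
  have hy'u : u ≠ g1 y := fun h => hxy (g1.injective (h1x.trans h))
  have hg0 := mul_mem_perms (swap_mem_perms hy' hv) hg1
  set g0 := Equiv.swap (g1 y) v * g1 with hg0_def
  have h0x : g0 x = u := by
    rw [hg0_def, Equiv.Perm.mul_apply, h1x, Equiv.swap_apply_of_ne_of_ne hy'u huv]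
  have h0y : g0 y = v := by rw [hg0_def, Equiv.Perm.mul_apply, Equiv.swap_apply_left]
  have hcard : #((V.erase u).erase v) = #V - 2 := by
    rw [card_erase_of_mem (mem_erase.2 ⟨huv.symm, hv⟩), card_erase_of_mem hu]
    omega
  rw [← hcard, ← card_perms_of_finset]
  refine card_nbij' (fun g => g * g0⁻¹) (fun h => h * g0) ?_ ?_ (fun g _ => by simp)
    (fun g _ => by simp)
  · intro g hg
    obtain ⟨hg, hgx, hgy⟩ := mem_filter.1 hg
    refine mem_permsOfFinset.2 fun z hz => ?_
    by_cases hzu : z = u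
    · rw [hzu, Equiv.Perm.mul_apply, Equiv.Perm.inv_eq_iff_eq.2 h0x.symm, hgx]
    by_cases hzv : z = v
    · rw [hzv, Equiv.Perm.mul_apply, Equiv.Perm.inv_eq_iff_eq.2 h0y.symm, hgy]
    exact mem_permsOfFinset.1 (mul_mem_perms hg (inv_mem_perms hg0)) z fun h =>
      hz (mem_erase.2 ⟨hzv, mem_erase.2 ⟨hzu, h⟩⟩)
  · intro h hh
    have hh' := mem_permsOfFinset.1 hh
    refine mem_filter.2 ⟨mul_mem_perms (perms_mono ?_ hh) hg0, ?_, ?_⟩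
    · exact (erase_subset _ _).trans (erase_subset _ _)
    · rw [Equiv.Perm.mul_apply, h0x, hh' u (by simp)]
    · rw [Equiv.Perm.mul_apply, h0y, hh' v (by simp)]

theorem sum_perms_eq_sum_offDiag {V : Finset ℕ} {x y : ℕ} (hx : x ∈ V) (hy : y ∈ V) (hxy : x ≠ y)
    (X : Equiv.Perm ℕ → ℝ) :
    ∑ g ∈ permsOfFinset V, X g = ∑ e ∈ V.offDiag, ∑ g ∈ permsWith V x y e.1 e.2, X g := by
  rw [← sum_fiberwise_of_maps_to (s := permsOfFinset V) (t := V.offDiag)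
    (g := fun g => (g x, g y)) (fun g hg => mem_offDiag.2 ⟨apply_mem hg hx, apply_mem hg hy,
      fun h => hxy (g.injective h)⟩)]
  refine sum_congr rfl fun e _ => sum_congr ?_ fun _ _ => rfl
  ext g
  simp [permsWith, Prod.ext_iff]

/-- The image of a point of `W` under a random permutation is uniform on `W`: right multiplication
by a transposition shows that the sum does not depend on `w`, and the sum over all `w` is trivial.
-/
theorem card_mul_sum_perms_apply {W : Finset ℕ} (f : ℕ → ℝ) {w : ℕ} (hw : w ∈ W) :
    #W * ∑ h ∈ permsOfFinset W, f (h w) = (#W).factorial * ∑ v ∈ W, f v := by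
  have h1 : ∀ w' ∈ W, ∑ h ∈ permsOfFinset W, f (h w') = ∑ h ∈ permsOfFinset W, f (h w) := by
    intro w' hw'
    have hs := swap_mem_perms hw hw'
    refine sum_nbij' (fun g => g * Equiv.swap w w') (fun g => g * Equiv.swap w w')
      (fun g hg => mul_mem_perms hg hs) (fun g hg => mul_mem_perms hg hs) ?_ ?_ ?_
    · intro g _
      simp [mul_assoc]
    · intro g _
      simp [mul_assoc]
    · intro g _
      simp
  rw [← nsmul_eq_mul, ← sum_const, ← sum_congr rfl h1, sum_comm,
    sum_congr rfl fun h hh => sum_perm_apply hh f, sum_const, card_perms_of_finset, nsmul_eq_mul]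

/-- The number of elements of `V` below `v`. -/
def rank (V : Finset ℕ) (v : ℕ) : ℕ := #{w ∈ V | w < v}

theorem rank_lt_card {V : Finset ℕ} {v : ℕ} (hv : v ∈ V) : rank V v < #V :=
  card_lt_card (filter_ssubset.2 ⟨v, hv, lt_irrefl v⟩)

theorem rank_lt_rank {V : Finset ℕ} {u v : ℕ} (hu : u ∈ V) (huv : u < v) :
    rank V u < rank V v := by
  refine card_lt_card ⟨fun w hw => ?_, fun h => ?_⟩
  · rw [mem_filter] at *
    exact ⟨hw.1, hw.2.trans huv⟩
  · have := h (mem_filter.2 ⟨hu, huv⟩)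
    simp at this

theorem rank_lt_rank_iff {V : Finset ℕ} {u v : ℕ} (hu : u ∈ V) (hv : v ∈ V) :
    rank V u < rank V v ↔ u < v := by
  refine ⟨fun h => ?_, rank_lt_rank hu⟩
  by_contra hc
  rcases (not_lt.1 hc).eq_or_lt with rfl | h'
  · exact lt_irrefl _ h
  · exact lt_asymm h (rank_lt_rank hv h')

theorem rank_injOn (V : Finset ℕ) : Set.InjOn (rank V) V := by
  intro u hu v hv h
  rcases lt_trichotomy u v with h' | h' | h'
  · have := rank_lt_rank hu h'
    omega
  · exact h'
  · have := rank_lt_rank hv h'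
    omega

theorem image_rank (V : Finset ℕ) : V.image (rank V) = range #V :=
  eq_of_subset_of_card_le (fun i hi => by
    obtain ⟨v, hv, rfl⟩ := mem_image.1 hi
    exact mem_range.2 (rank_lt_card hv)) (by rw [card_range, card_image_of_injOn (rank_injOn V)])

theorem sum_rank (V : Finset ℕ) (f : ℕ → ℝ) : ∑ v ∈ V, f (rank V v) = ∑ i ∈ range #V, f i := by
  rw [← image_rank, sum_image (rank_injOn V)]

theorem rank_add_card_gt {V : Finset ℕ} {v : ℕ} (hv : v ∈ V) :
    rank V v + 1 + #{w ∈ V | v < w} = #V := by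
  have h1 : {w ∈ V | ¬ w < v} = insert v {w ∈ V | v < w} := by
    ext w
    simp only [mem_filter, mem_insert]
    grind
  have h2 := card_filter_add_card_filter_not (s := V) (fun w => w < v)
  rw [h1, card_insert_of_notMem (by simp)] at h2
  unfold rank
  omega

theorem rank_add_card_between {V : Finset ℕ} {u v : ℕ} (hu : u ∈ V) (huv : u < v) :
    rank V u + 1 + #{w ∈ V | u < w ∧ w < v} = rank V v := by
  have h1 : {w ∈ {w ∈ V | w < v} | w < u} = {w ∈ V | w < u} := by
    ext w
    simp only [mem_filter]
    grind
  have h2 : {w ∈ {w ∈ V | w < v} | u < w} = {w ∈ V | u < w ∧ w < v} := by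
    ext w
    simp only [mem_filter]
    grind
  have := rank_add_card_gt (V := {w ∈ V | w < v}) (v := u) (by simp [hu, huv])
  rw [rank, h1, h2] at this
  exact this

/-- Passes from ordered pairs of pivots to pairs of ranks `i < j`; the two orders of the same pivots
are added up in `F`. -/
theorem sum_offDiag_rank (V : Finset ℕ) (Φ : ℕ → ℕ → ℝ) (F : ℕ → ℕ → ℝ)
    (hF : ∀ u ∈ V, ∀ v ∈ V, u < v → Φ u v + Φ v u = F (rank V u) (rank V v)) :
    ∑ e ∈ V.offDiag, Φ e.1 e.2 = ∑ j ∈ range #V, ∑ i ∈ range j, F i j := by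
  have h1 : ∑ e ∈ V.offDiag, Φ e.1 e.2 = ∑ v ∈ V, ∑ u ∈ V, if u < v then Φ u v + Φ v u else 0 := by
    have h2 : ∑ e ∈ V.offDiag, Φ e.1 e.2 = ∑ v ∈ V, ∑ u ∈ V, if u ≠ v then Φ u v else 0 := by
      rw [sum_comm, ← sum_product', ← sum_filter]
      refine sum_congr ?_ fun _ _ => rfl
      ext e
      simp [and_assoc]
    have h3 : ∀ u v, (if u ≠ v then Φ u v else 0) =
        (if u < v then Φ u v else 0) + if v < u then Φ u v else 0 := by
      intro u v
      rcases lt_trichotomy u v with h | h | h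
      · simp [h, h.ne, h.le]
      · simp [h]
      · simp [h, h.ne', h.le]
    have h4 : ∑ v ∈ V, ∑ u ∈ V, (if v < u then Φ u v else 0) =
      ∑ v ∈ V, ∑ u ∈ V, if u < v then Φ v u else 0 := sum_comm
    simp_rw [h2, h3, sum_add_distrib]
    rw [h4, ← sum_add_distrib]
    refine sum_congr rfl fun v _ => ?_
    rw [← sum_add_distrib]
    refine sum_congr rfl fun u _ => ?_
    split_ifs <;> simp
  have h5 : ∀ v ∈ V, ∑ u ∈ V, (if u < v then Φ u v + Φ v u else 0) =
      ∑ i ∈ range (rank V v), F i (rank V v) := by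
    intro v hv
    have h6 : ∀ u ∈ V, (if u < v then Φ u v + Φ v u else 0) =
        (fun i => if i < rank V v then F i (rank V v) else 0) (rank V u) := by
      intro u hu
      simp only [rank_lt_rank_iff hu hv]
      split_ifs with h
      · exact hF u hu v hv h
      · rfl
    rw [sum_congr rfl h6]
    refine (sum_rank V fun i => if i < rank V v then F i (rank V v) else 0).trans ?_
    rw [← sum_filter]
    refine sum_congr ?_ fun _ _ => rfl
    ext i
    have := rank_lt_card hv
    simp only [mem_filter, mem_range]
    omega
  rw [h1, sum_congr rfl h5]
  exact sum_rank V fun j => ∑ i ∈ range j, F i j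

/-! ### The key sets of the subfiles, and the partitioning step on all arrangements at once. -/

theorem card_of_bijOn_Icc {f : ℤ → ℕ} {l r : ℤ} {V : Finset ℕ}
    (h : Set.BijOn f (Set.Icc l r) V) : #V = (r + 1 - l).toNat := by
  rw [← Int.card_Icc]
  rw [← coe_Icc] at h
  exact h.finsetCard_eq.symm

namespace Partitioned

variable {m : Mem} {l r : ℤ} {p q : ℕ} {s : State} {a : ℤ} {x : ℕ}

theorem bijOn (H : Partitioned m l r p q s a x) {V : Finset ℕ}
    (h : Set.BijOn m.arr (Set.Icc l r) V) : Set.BijOn s.arr (Set.Icc l r) V := by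
  obtain ⟨σ, -, hσ, hf⟩ := H.perm_mem
  have h1 : Set.MapsTo s.arr (Set.Icc l r) V := fun k hk => by
    rw [hf]
    exact h.mapsTo (hσ k hk.1 hk.2)
  have h2 := H.injOn h.injOn
  refine ⟨h1, h2, ?_⟩
  rw [← coe_Icc] at h1 h2 ⊢
  refine (surjOn_of_injOn_of_card_le _ h1 h2 ?_)
  rw [card_of_bijOn_Icc h, Int.card_Icc]

theorem bijOn_small (H : Partitioned m l r p q s a x) {V : Finset ℕ} (hpq : p ≤ q)
    (h : Set.BijOn m.arr (Set.Icc l r) V) :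
    Set.BijOn s.arr (Set.Icc l (s.i₁ - 1)) ({w ∈ V | w < p} : Finset ℕ) := by
  have h1 := H.hl
  have h2 := H.hij
  have h3 := H.hr
  have hb := H.bijOn h
  refine ⟨fun k hk => ?_, hb.injOn.mono (Set.Icc_subset_Icc le_rfl (by omega)), fun w hw => ?_⟩
  · rw [Set.mem_Icc] at hk
    exact mem_filter.2 ⟨hb.mapsTo ⟨by omega, by omega⟩, H.small k (by omega) (by omega)⟩
  · obtain ⟨hwV, hwp⟩ := mem_filter.1 hw
    obtain ⟨k, hk, rfl⟩ := hb.surjOn hwV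
    refine ⟨k, ⟨hk.1, ?_⟩, rfl⟩
    by_contra hc
    have := H.medium k
    have := H.large k
    have := H.arr_i₁
    have := H.arr_j₁
    grind

theorem bijOn_medium (H : Partitioned m l r p q s a x) {V : Finset ℕ}
    (h : Set.BijOn m.arr (Set.Icc l r) V) :
    Set.BijOn s.arr (Set.Icc (s.i₁ + 1) (s.j₁ - 1)) ({w ∈ V | p < w ∧ w < q} : Finset ℕ) := by
  have h1 := H.hl
  have h2 := H.hij
  have h3 := H.hr
  have hb := H.bijOn h
  refine ⟨fun k hk => ?_, hb.injOn.mono (Set.Icc_subset_Icc (by omega) (by omega)), fun w hw => ?_⟩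
  · rw [Set.mem_Icc] at hk
    exact mem_filter.2 ⟨hb.mapsTo ⟨by omega, by omega⟩, H.medium k (by omega) (by omega)⟩
  · obtain ⟨hwV, hwp, hwq⟩ := mem_filter.1 hw
    obtain ⟨k, hk, rfl⟩ := hb.surjOn hwV
    refine ⟨k, ?_, rfl⟩
    by_contra hc
    rw [Set.mem_Icc] at hc hk
    have := H.small k
    have := H.large k
    have := H.arr_i₁
    have := H.arr_j₁
    grind

theorem bijOn_large (H : Partitioned m l r p q s a x) {V : Finset ℕ} (hpq : p ≤ q)
    (h : Set.BijOn m.arr (Set.Icc l r) V) :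
    Set.BijOn s.arr (Set.Icc (s.j₁ + 1) r) ({w ∈ V | q < w} : Finset ℕ) := by
  have h1 := H.hl
  have h2 := H.hij
  have h3 := H.hr
  have hb := H.bijOn h
  refine ⟨fun k hk => ?_, hb.injOn.mono (Set.Icc_subset_Icc (by omega) le_rfl), fun w hw => ?_⟩
  · rw [Set.mem_Icc] at hk
    exact mem_filter.2 ⟨hb.mapsTo ⟨by omega, by omega⟩, H.large k (by omega) (by omega)⟩
  · obtain ⟨hwV, hwq⟩ := mem_filter.1 hw
    obtain ⟨k, hk, rfl⟩ := hb.surjOn hwV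
    refine ⟨k, ⟨?_, hk.2⟩, rfl⟩
    by_contra hc
    rw [Set.mem_Icc] at hk
    have := H.small k
    have := H.medium k
    have := H.arr_i₁
    have := H.arr_j₁
    grind

end Partitioned

/-- The memories `M g` hold on the range `l, …, r` all arrangements of the keys in `V`, and
`S g` are the states after the partitioning step, with data `A g` and `X g` as in
`Partitioned`. -/
structure Family (l r : ℤ) (V : Finset ℕ) (a : ℤ → ℕ) (M : Equiv.Perm ℕ → Mem)
    (S : Equiv.Perm ℕ → State) (A : Equiv.Perm ℕ → ℤ) (X : Equiv.Perm ℕ → ℕ) : Prop where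
  lt : l < r
  bij : Set.BijOn a (Set.Icc l r) V
  arr : ∀ g ∈ permsOfFinset V, ∀ t, l ≤ t → t ≤ r → (M g).arr t = g (a t)
  eq : ∀ g ∈ permsOfFinset V, partitionStep (M g) l r = some (S g)
  part : ∀ g ∈ permsOfFinset V, Partitioned (M g) l r (min (g (a l)) (g (a r)))
    (max (g (a l)) (g (a r))) (S g) (A g) (X g)
  rel : ∀ g ∈ permsOfFinset V, ∀ h ∈ permsOfFinset V,
    PreservesClasses h (min (g (a l)) (g (a r))) (max (g (a l)) (g (a r))) →
    h (g (a l)) = g (a l) → h (g (a r)) = g (a r) → (S g).Rel h l r (S (h * g))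

theorem bijOn_arrangement {l r : ℤ} {V : Finset ℕ} {a : ℤ → ℕ}
    (bij : Set.BijOn a (Set.Icc l r) V) {g : Equiv.Perm ℕ} (hg : g ∈ permsOfFinset V) {m : Mem}
    (arr : ∀ t, l ≤ t → t ≤ r → m.arr t = g (a t)) : Set.BijOn m.arr (Set.Icc l r) V := by
  have h1 : Set.BijOn g V V := by
    refine ⟨fun x hx => apply_mem hg hx, g.injective.injOn, fun x hx => ?_⟩
    exact ⟨g⁻¹ x, apply_mem (inv_mem_perms hg) hx, by simp⟩
  exact (h1.comp bij).congr fun t ht => (arr t ht.1 ht.2).symm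

theorem exists_family {l r : ℤ} (hlr : l < r) {V : Finset ℕ} {a : ℤ → ℕ}
    {M : Equiv.Perm ℕ → Mem} (bij : Set.BijOn a (Set.Icc l r) V)
    (arr : ∀ g ∈ permsOfFinset V, ∀ t, l ≤ t → t ≤ r → (M g).arr t = g (a t)) :
    ∃ S A X, Family l r V a M S A X := by
  have h1 : ∀ g : Equiv.Perm ℕ, ∃ s b x, g ∈ permsOfFinset V →
      partitionStep (M g) l r = some s ∧ Partitioned (M g) l r (min (g (a l)) (g (a r)))
        (max (g (a l)) (g (a r))) s b x ∧
      ∀ h m', PreservesClasses h (min (g (a l)) (g (a r))) (max (g (a l)) (g (a r))) →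
        h (min (g (a l)) (g (a r))) = min (g (a l)) (g (a r)) →
        h (max (g (a l)) (g (a r))) = max (g (a l)) (g (a r)) →
        (∀ k, l ≤ k → k ≤ r → m'.arr k = h ((M g).arr k)) →
        ∃ s', partitionStep m' l r = some s' ∧ s.Rel h l r s' := by
    intro g
    by_cases hg : g ∈ permsOfFinset V
    · obtain ⟨s, b, x, h⟩ := partitionStep_spec (M g) hlr
        (bijOn_arrangement bij hg (arr g hg)).injOn (p := min (g (a l)) (g (a r)))
        (q := max (g (a l)) (g (a r)))
        (by rw [arr g hg l le_rfl hlr.le, arr g hg r hlr.le le_rfl])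
        (by rw [arr g hg l le_rfl hlr.le, arr g hg r hlr.le le_rfl])
      exact ⟨s, b, x, fun _ => h⟩
    -- Arbitrary values: nothing is claimed for permutations that move keys outside `V`.
    · exact ⟨startState (M g) l r, 0, 0, fun h => (hg h).elim⟩
  choose S A X h using h1
  refine ⟨S, A, X, hlr, bij, arr, fun g hg => (h g hg).1, fun g hg => (h g hg).2.1, ?_⟩
  intro g hg τ hτ hc hl hr
  obtain ⟨s', e, R⟩ := (h g hg).2.2 τ (M (τ * g)) hc
    (by rcases le_total (g (a l)) (g (a r)) with h | h <;> simp [h, hl, hr])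
    (by rcases le_total (g (a l)) (g (a r)) with h | h <;> simp [h, hl, hr])
    (fun t ht ht' => by
      rw [arr _ (mul_mem_perms hτ hg) t ht ht', arr g hg t ht ht', Equiv.Perm.mul_apply])
  rw [(h (τ * g) (mul_mem_perms hτ hg)).1] at e
  rw [Option.some.inj e]
  exact R

theorem mul_mem_permsWith {V W : Finset ℕ} {x y u v : ℕ} (hW : W ⊆ V) (hu : u ∉ W) (hv : v ∉ W)
    {h g : Equiv.Perm ℕ} (hh : h ∈ permsOfFinset W) (hg : g ∈ permsWith V x y u v) :
    h * g ∈ permsWith V x y u v := by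
  obtain ⟨hg, hx, hy⟩ := mem_filter.1 hg
  refine mem_filter.2 ⟨mul_mem_perms (perms_mono hW hh) hg, ?_, ?_⟩
  · rw [Equiv.Perm.mul_apply, hx, mem_permsOfFinset.1 hh u hu]
  · rw [Equiv.Perm.mul_apply, hy, mem_permsOfFinset.1 hh v hv]

theorem preservesClasses_of_mem {W : Finset ℕ} {p q : ℕ} {h : Equiv.Perm ℕ}
    (hh : h ∈ permsOfFinset W)
    (hW : ∀ w ∈ W, ∀ w' ∈ W, (w' < p ↔ w < p) ∧ (q < w' ↔ q < w)) : PreservesClasses h p q := by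
  intro x
  by_cases hx : x ∈ W
  · exact hW x hx _ (apply_mem hh hx)
  · rw [mem_permsOfFinset.1 hh x hx]
    exact ⟨Iff.rfl, Iff.rfl⟩

/-! ### Mean cost of a step and of the recursive calls. -/

/-- The counters of a memory, weighted by `α` and `β`. -/
noncomputable def cost (α β : ℝ) (m : Mem) : ℝ := α * m.comps + β * m.swaps

/-- The mean cost for sorting `k` keys is `c`. -/
def IsMeanCost (α β : ℝ) (k : ℕ) (c : ℝ) : Prop :=
  ∀ (l r : ℤ) (V : Finset ℕ) (a : ℤ → ℕ) (M : Equiv.Perm ℕ → Mem), #V = k → r = l + k - 1 →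
    Set.BijOn a (Set.Icc l r) V →
    (∀ g ∈ permsOfFinset V, ∀ t, l ≤ t → t ≤ r → (M g).arr t = g (a t)) →
    ∑ g ∈ permsOfFinset V, (cost α β (sorted (M g) l r) - cost α β (M g)) = k.factorial * c

/-- The mean cost of a partitioning step with `s` small and `L` large keys out of `n`;
`e` is `1` or `0` according to whether the pivots are exchanged or not. -/
noncomputable def stepMean (α β : ℝ) (n s L : ℕ) (e : ℝ) : ℝ :=
  α * (2 * (n - 1) - 2 * (s * L / (s + L : ℕ))) + β * (e + 2 + s + L)

namespace Family

variable {l r : ℤ} {V : Finset ℕ} {a : ℤ → ℕ} {M : Equiv.Perm ℕ → Mem}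
  {S : Equiv.Perm ℕ → State} {A : Equiv.Perm ℕ → ℤ} {X : Equiv.Perm ℕ → ℕ} {u v : ℕ}
  {g h : Equiv.Perm ℕ} {α β : ℝ}

theorem left_mem (F : Family l r V a M S A X) : a l ∈ V := F.bij.mapsTo ⟨le_rfl, F.lt.le⟩

theorem right_mem (F : Family l r V a M S A X) : a r ∈ V := F.bij.mapsTo ⟨F.lt.le, le_rfl⟩

theorem left_ne_right (F : Family l r V a M S A X) : a l ≠ a r := fun h =>
  F.lt.ne (F.bij.injOn ⟨le_rfl, F.lt.le⟩ ⟨F.lt.le, le_rfl⟩ h)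

theorem card_eq (F : Family l r V a M S A X) : (#V : ℤ) = r + 1 - l := by
  have := card_of_bijOn_Icc F.bij
  have := F.lt
  omega

theorem partitioned (F : Family l r V a M S A X) (hg : g ∈ permsWith V (a l) (a r) u v) :
    Partitioned (M g) l r (min u v) (max u v) (S g) (A g) (X g) := by
  obtain ⟨hg', rfl, rfl⟩ := mem_filter.1 hg
  exact F.part g hg'

theorem bijOn (F : Family l r V a M S A X) (hg : g ∈ permsOfFinset V) :
    Set.BijOn (M g).arr (Set.Icc l r) V :=
  bijOn_arrangement F.bij hg (F.arr g hg)

theorem i₁_eq (F : Family l r V a M S A X) (hg : g ∈ permsWith V (a l) (a r) u v) :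
    (S g).i₁ = l + #{w ∈ V | w < min u v} := by
  have H := F.partitioned hg
  have := card_of_bijOn_Icc (H.bijOn_small min_le_max (F.bijOn (mem_filter.1 hg).1))
  have := H.hl
  omega

theorem j₁_eq (F : Family l r V a M S A X) (hg : g ∈ permsWith V (a l) (a r) u v) :
    (S g).j₁ = r - #{w ∈ V | max u v < w} := by
  have H := F.partitioned hg
  have := card_of_bijOn_Icc (H.bijOn_large min_le_max (F.bijOn (mem_filter.1 hg).1))
  have := H.hr
  omega

theorem j₁_eq' (F : Family l r V a M S A X) (hg : g ∈ permsWith V (a l) (a r) u v) :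
    (S g).j₁ - 1 = (S g).i₁ + 1 + #{w ∈ V | min u v < w ∧ w < max u v} - 1 := by
  have H := F.partitioned hg
  have := card_of_bijOn_Icc (H.bijOn_medium (F.bijOn (mem_filter.1 hg).1))
  have := H.hij
  omega

theorem rel_of_mem (F : Family l r V a M S A X) {W : Finset ℕ} (hWV : W ⊆ V)
    (hg : g ∈ permsWith V (a l) (a r) u v) (hh : h ∈ permsOfFinset W) (hu : u ∉ W) (hv : v ∉ W)
    (hW : ∀ w ∈ W, ∀ w' ∈ W, (w' < min u v ↔ w < min u v) ∧ (max u v < w' ↔ max u v < w)) :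
    (S g).Rel h l r (S (h * g)) := by
  obtain ⟨hg', rfl, rfl⟩ := mem_filter.1 hg
  exact F.rel g hg' h (perms_mono hWV hh) (preservesClasses_of_mem hh hW)
    (mem_permsOfFinset.1 hh _ hu) (mem_permsOfFinset.1 hh _ hv)

/-- Randomness of the subfiles. For fixed `g`, let `h` run through the permutations of the class
`W`. By equivariance the pointers of `S (h * g)` are those of `S g`, and the subfile holds the keys
of `S g` relabelled by `h`, that is, all arrangements of `W`. So `IsMeanCost` applies to each orbit,
and `sum_of_average` collects the orbits. The memory `N g` in which the call starts may differ from
`S g` outside the subfile and in its counters. -/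
theorem sum_subfile (F : Family l r V a M S A X) {W : Finset ℕ} (hWV : W ⊆ V)
    (hu : u ∉ W) (hv : v ∉ W)
    (hW : ∀ w ∈ W, ∀ w' ∈ W, (w' < min u v ↔ w < min u v) ∧ (max u v < w' ↔ max u v < w))
    {C : ℝ} (hC : IsMeanCost α β #W C) (lo hi : State → ℤ)
    (hlo : ∀ g ∈ permsWith V (a l) (a r) u v, l ≤ lo (S g))
    (hhi : ∀ g ∈ permsWith V (a l) (a r) u v, hi (S g) ≤ r)
    (hlohi : ∀ s s' : State, s.i₁ = s'.i₁ → s.j₁ = s'.j₁ → lo s = lo s' ∧ hi s = hi s')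
    (hcard : ∀ g ∈ permsWith V (a l) (a r) u v, hi (S g) = lo (S g) + #W - 1)
    (hbij : ∀ g ∈ permsWith V (a l) (a r) u v,
      Set.BijOn (S g).arr (Set.Icc (lo (S g)) (hi (S g))) W)
    (N : Equiv.Perm ℕ → Mem)
    (hN : ∀ g ∈ permsWith V (a l) (a r) u v, ∀ t, lo (S g) ≤ t → t ≤ hi (S g) →
      (N g).arr t = (S g).arr t) :
    ∑ g ∈ permsWith V (a l) (a r) u v,
      (cost α β (sorted (N g) (lo (S g)) (hi (S g))) - cost α β (N g)) =
        #(permsWith V (a l) (a r) u v) * C := by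
  refine sum_of_average (W := W) (fun h hh g hg => mul_mem_permsWith hWV hu hv hh hg) _ C ?_
  intro g hg
  rw [← hC (lo (S g)) (hi (S g)) W (S g).arr (fun h => N (h * g)) rfl (hcard g hg) (hbij g hg) ?_]
  · refine sum_congr rfl fun h hh => ?_
    have R := F.rel_of_mem hWV hg hh hu hv hW
    rw [(hlohi _ _ R.i₁ R.j₁).1, (hlohi _ _ R.i₁ R.j₁).2]
  · intro h hh t ht ht'
    have R := F.rel_of_mem hWV hg hh hu hv hW
    rw [hN _ (mul_mem_permsWith hWV hu hv hh hg) t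
      (by rw [(hlohi _ _ R.i₁ R.j₁).1]; exact ht) (by rw [(hlohi _ _ R.i₁ R.j₁).2]; exact ht'),
      R.arr t ((hlo g hg).trans ht) (ht'.trans (hhi g hg))]

theorem sum_recursion (F : Family l r V a M S A X) (hu : u ∈ V) (hv : v ∈ V) (huv : u ≠ v)
    {c₁ c₂ c₃ : ℝ} (h₁ : IsMeanCost α β #{w ∈ V | w < min u v} c₁)
    (h₂ : IsMeanCost α β #{w ∈ V | min u v < w ∧ w < max u v} c₂)
    (h₃ : IsMeanCost α β #{w ∈ V | max u v < w} c₃) :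
    ∑ g ∈ permsWith V (a l) (a r) u v, (cost α β (sorted (M g) l r) - cost α β (S g).toMem) =
      (#V - 2).factorial * (c₁ + c₂ + c₃) := by
  have hΓ := card_permsWith F.left_mem F.right_mem F.left_ne_right hu hv huv
  have hsort : ∀ g ∈ permsWith V (a l) (a r) u v, _ := fun g hg =>
    sorted_eq F.lt (F.bijOn (mem_filter.1 hg).1).injOn (F.eq g (mem_filter.1 hg).1)
      (F.partitioned hg)
  have e1 := F.sum_subfile (u := u) (v := v) (W := {w ∈ V | w < min u v}) (filter_subset _ _)
    (by simp) (by simp) (fun w hw w' hw' => by rw [mem_filter] at hw hw'; omega) h₁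
    (fun _ => l) (fun s => s.i₁ - 1) (fun g hg => le_rfl)
    (fun g hg => by
      have := (F.partitioned hg).hij
      have := (F.partitioned hg).hr
      omega)
    (fun s s' hi _ => ⟨rfl, by rw [hi]⟩) (fun g hg => by rw [F.i₁_eq hg])
    (fun g hg => (F.partitioned hg).bijOn_small min_le_max (F.bijOn (mem_filter.1 hg).1))
    (fun g => (S g).toMem) (fun g hg t _ _ => rfl)
  have e2 := F.sum_subfile (u := u) (v := v) (W := {w ∈ V | min u v < w ∧ w < max u v})
    (filter_subset _ _)
    (by simp; omega) (by simp; omega) (fun w hw w' hw' => by rw [mem_filter] at hw hw'; omega) h₂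
    (fun s => s.i₁ + 1) (fun s => s.j₁ - 1)
    (fun g hg => by
      have := (F.partitioned hg).hl
      omega)
    (fun g hg => by
      have := (F.partitioned hg).hr
      omega)
    (fun s s' hi hj => ⟨by rw [hi], by rw [hj]⟩) (fun g hg => by rw [F.j₁_eq' hg])
    (fun g hg => (F.partitioned hg).bijOn_medium (F.bijOn (mem_filter.1 hg).1))
    (fun g => sorted (S g).toMem l ((S g).i₁ - 1))
    (fun g hg t ht _ => (hsort g hg).2.1 t (by omega))
  have e3 := F.sum_subfile (u := u) (v := v) (W := {w ∈ V | max u v < w})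
    (filter_subset _ _)
    (by simp) (by simp) (fun w hw w' hw' => by rw [mem_filter] at hw hw'; omega) h₃
    (fun s => s.j₁ + 1) (fun _ => r)
    (fun g hg => by
      have := (F.partitioned hg).hl
      have := (F.partitioned hg).hij
      omega)
    (fun g hg => le_rfl)
    (fun s s' _ hj => ⟨by rw [hj], rfl⟩) (fun g hg => by rw [F.j₁_eq hg]; ring)
    (fun g hg => (F.partitioned hg).bijOn_large min_le_max (F.bijOn (mem_filter.1 hg).1))
    (fun g => sorted (sorted (S g).toMem l ((S g).i₁ - 1)) ((S g).i₁ + 1) ((S g).j₁ - 1))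
    (fun g hg t ht _ => (hsort g hg).2.2 t (by omega))
  rw [hΓ] at e1 e2 e3
  rw [mul_add, mul_add, ← e1, ← e2, ← e3, ← sum_add_distrib, ← sum_add_distrib]
  refine sum_congr rfl fun g hg => ?_
  rw [(hsort g hg).1]
  ring

/-- The keys which are not medium. -/
def outer (V : Finset ℕ) (u v : ℕ) : Finset ℕ := {w ∈ V | w < min u v ∨ max u v < w}

theorem card_outer (V : Finset ℕ) (u v : ℕ) :
    #(outer V u v) = #{w ∈ V | w < min u v} + #{w ∈ V | max u v < w} := by
  rw [outer, filter_or, card_union_of_disjoint]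
  refine disjoint_filter.2 fun w _ h h' => ?_
  omega

theorem outer_positions (F : Family l r V a M S A X) (hg : g ∈ permsWith V (a l) (a r) u v)
    {k : ℤ} (hk : k ∈ Ioo l r) :
    ((M g).arr k < min u v ∨ max u v < (M g).arr k) ↔ (M g).arr k ∈ outer V u v := by
  rw [mem_Ioo] at hk
  exact ⟨fun h => mem_filter.2 ⟨(F.bijOn (mem_filter.1 hg).1).mapsTo ⟨hk.1.le, hk.2.le⟩, h⟩,
    fun h => (mem_filter.1 h).2⟩

/-- Here `h` mixes small and large keys, so the path of the program does change. The positions of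
non-medium keys do not, and in both runs `i` passes as many of them as there are small keys. As `i`
passes an initial segment, they are the same positions. -/
theorem exch_mul (F : Family l r V a M S A X) (hg : g ∈ permsWith V (a l) (a r) u v)
    (hh : h ∈ permsOfFinset (outer V u v)) :
    X (h * g) = #{k ∈ {k ∈ Ioo l (A g) | (M g).arr k < min u v ∨ max u v < (M g).arr k} |
      max u v < h ((M g).arr k)} := by
  have hg' := mul_mem_permsWith (filter_subset _ _) (by simp) (by simp) hh hg
  have H := F.partitioned hg
  have H' := F.partitioned hg'
  have ha := H.har
  have ha' := H'.har
  have harr : ∀ k, l ≤ k → k ≤ r → (M (h * g)).arr k = h ((M g).arr k) := fun k hk hk' => by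
    rw [F.arr _ (mem_filter.1 hg').1 k hk hk', F.arr _ (mem_filter.1 hg).1 k hk hk',
      Equiv.Perm.mul_apply]
  have hiff : ∀ k ∈ Ioo l r, ((M (h * g)).arr k < min u v ∨ max u v < (M (h * g)).arr k) ↔
      ((M g).arr k < min u v ∨ max u v < (M g).arr k) := by
    intro k hk
    rw [F.outer_positions hg hk, F.outer_positions hg' hk]
    rw [mem_Ioo] at hk
    rw [harr k hk.1.le hk.2.le]
    constructor
    · intro hm
      have := apply_mem (inv_mem_perms hh) hm
      rwa [← Equiv.Perm.mul_apply, inv_mul_cancel, Equiv.Perm.one_apply] at this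
    · exact apply_mem hh
  have hN : {k ∈ Ioo l (A (h * g)) | (M (h * g)).arr k < min u v ∨ max u v < (M (h * g)).arr k} =
      {k ∈ Ioo l (A g) | (M g).arr k < min u v ∨ max u v < (M g).arr k} := by
    have hfil : {k ∈ Ioo l (A (h * g)) | (M (h * g)).arr k < min u v ∨
        max u v < (M (h * g)).arr k} = {k ∈ Ioo l (A (h * g)) | (M g).arr k < min u v ∨
        max u v < (M g).arr k} := by
      refine filter_congr fun k hk => hiff k ?_
      rw [mem_Ioo] at *
      omega
    have hcard : #{k ∈ Ioo l (A (h * g)) | (M g).arr k < min u v ∨ max u v < (M g).arr k} =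
        #{k ∈ Ioo l (A g) | (M g).arr k < min u v ∨ max u v < (M g).arr k} := by
      have e1 := H.left
      have e2 := H'.left
      rw [F.i₁_eq hg] at e1
      rw [F.i₁_eq hg', hfil] at e2
      omega
    rw [hfil]
    -- Two initial segments cut out nested sets of non-medium positions; having equal size, these
    -- coincide. The end points `A g` and `A (h * g)` themselves may differ.
    rcases le_total (A g) (A (h * g)) with hle | hle
    · exact (eq_of_subset_of_card_le (filter_subset_filter _ (Ioo_subset_Ioo_right hle))
        hcard.le).symm
    · exact eq_of_subset_of_card_le (filter_subset_filter _ (Ioo_subset_Ioo_right hle)) hcard.ge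
  rw [H'.exch, ← hN, filter_filter]
  congr 1
  refine filter_congr fun k hk => ?_
  rw [mem_Ioo] at hk
  rw [harr k hk.1.le (by omega)]
  exact ⟨fun h => ⟨Or.inr h, h⟩, fun h => h.2⟩

/-- On each orbit under permutations of the non-medium keys, `X` counts the large keys in a fixed
set `P` of positions, as many as there are small keys. Each of these positions receives a large key
with probability `L/(s+L)`. -/
theorem sum_exch (F : Family l r V a M S A X) (hu : u ∈ V) (hv : v ∈ V) (huv : u ≠ v) :
    ∑ g ∈ permsWith V (a l) (a r) u v, (X g : ℝ) = (#V - 2).factorial *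
      ((#{w ∈ V | w < min u v} : ℝ) * #{w ∈ V | max u v < w} /
        (#{w ∈ V | w < min u v} + #{w ∈ V | max u v < w} : ℕ)) := by
  rw [← card_permsWith F.left_mem F.right_mem F.left_ne_right hu hv huv]
  refine sum_of_average (W := outer V u v) (fun h hh g hg =>
    mul_mem_permsWith (filter_subset _ _) (by simp) (by simp) hh hg) _ _ ?_
  intro g hg
  rw [← card_outer]
  have H := F.partitioned hg
  set P := {k ∈ Ioo l (A g) | (M g).arr k < min u v ∨ max u v < (M g).arr k} with hP
  have hPcard : #P = #{w ∈ V | w < min u v} := by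
    have := H.left
    rw [F.i₁_eq hg, ← hP] at this
    omega
  have h1 : ∑ h ∈ permsOfFinset (outer V u v), (X (h * g) : ℝ) =
      ∑ k ∈ P, ∑ h ∈ permsOfFinset (outer V u v),
        (fun w => if max u v < w then (1 : ℝ) else 0) (h ((M g).arr k)) := by
    rw [sum_comm]
    refine sum_congr rfl fun h hh => ?_
    rw [F.exch_mul hg hh, ← hP, sum_boole]
  have h2 : ∑ w ∈ outer V u v, (if max u v < w then (1 : ℝ) else 0) = #{w ∈ V | max u v < w} := by
    rw [sum_boole, outer, filter_filter]
    congr 2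
    refine filter_congr fun w _ => ?_
    exact ⟨fun h => h.2, fun h => ⟨Or.inr h, h⟩⟩
  have h3 : ∀ k ∈ P, (#(outer V u v) : ℝ) * ∑ h ∈ permsOfFinset (outer V u v),
        (fun w => if max u v < w then (1 : ℝ) else 0) (h ((M g).arr k)) =
      (#(outer V u v)).factorial * #{w ∈ V | max u v < w} := by
    intro k hk
    obtain ⟨hk, hk'⟩ := mem_filter.1 hk
    rw [card_mul_sum_perms_apply (fun w => if max u v < w then (1 : ℝ) else 0)
      ((F.outer_positions hg (by have := H.har; rw [mem_Ioo] at *; omega)).1 hk'), h2]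
  have h4 : (#(outer V u v) : ℝ) * ∑ h ∈ permsOfFinset (outer V u v), (X (h * g) : ℝ) =
      #P * ((#(outer V u v)).factorial * #{w ∈ V | max u v < w}) := by
    rw [h1, mul_sum, sum_congr rfl h3, sum_const, nsmul_eq_mul]
  -- Without small and large keys the claimed mean is the quotient `0/0 = 0`, which is right since
  -- nothing is exchanged.
  rcases Nat.eq_zero_or_pos #(outer V u v) with h0 | h0
  · have hP0 : P = ∅ := by
      rw [← card_eq_zero, hPcard]
      rw [card_outer] at h0
      omega
    rw [h1, hP0, h0]
    simp
  · have h0' : (#(outer V u v) : ℝ) ≠ 0 := by positivity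
    apply mul_left_cancel₀ h0'
    rw [h4, hPcard]
    field_simp

theorem sum_step (F : Family l r V a M S A X) (hu : u ∈ V) (hv : v ∈ V) (huv : u ≠ v) :
    ∑ g ∈ permsWith V (a l) (a r) u v, (cost α β (S g).toMem - cost α β (M g)) =
      (#V - 2).factorial * stepMean α β #V #{w ∈ V | w < min u v} #{w ∈ V | max u v < w}
        (if v < u then 1 else 0) := by
  have hcard := F.card_eq
  have h1 : ∀ g ∈ permsWith V (a l) (a r) u v, cost α β (S g).toMem - cost α β (M g) =
      (α * (2 * (#V - 1)) + β * ((if v < u then 1 else 0) + 2 + #{w ∈ V | w < min u v} +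
        #{w ∈ V | max u v < w})) + (-2 * α) * X g := by
    intro g hg
    have H := F.partitioned hg
    have ec : ((S g).comps : ℝ) = (M g).comps + 2 * (#V - 1) - 2 * X g := by
      have := H.comps
      have h : ((S g).comps : ℤ) = (M g).comps + 2 * (#V - 1) - 2 * X g := by omega
      exact_mod_cast h
    have es : ((S g).swaps : ℝ) = (M g).swaps + (if v < u then 1 else 0) + 2 +
        #{w ∈ V | w < min u v} + #{w ∈ V | max u v < w} := by
      have := H.swaps
      obtain ⟨hg', hgu, hgv⟩ := mem_filter.1 hg
      rw [F.i₁_eq hg, F.j₁_eq hg, F.arr g hg' l le_rfl F.lt.le, F.arr g hg' r F.lt.le le_rfl,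
        hgu, hgv] at this
      have h : ((S g).swaps : ℤ) = (M g).swaps + (if v < u then 1 else 0) + 2 +
        #{w ∈ V | w < min u v} + #{w ∈ V | max u v < w} := by omega
      exact_mod_cast h
    rw [cost, cost, ec, es]
    ring
  rw [sum_congr rfl h1, sum_add_distrib, ← mul_sum, F.sum_exch hu hv huv, sum_const,
    card_permsWith F.left_mem F.right_mem F.left_ne_right hu hv huv, nsmul_eq_mul, stepMean]
  ring

end Family

theorem rank_data {V : Finset ℕ} {u v : ℕ} (hu : u ∈ V) (hv : v ∈ V) (huv : u < v) :
    #{w ∈ V | w < u} = rank V u ∧ #{w ∈ V | u < w ∧ w < v} = rank V v - 1 - rank V u ∧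
      #{w ∈ V | v < w} = #V - 1 - rank V v := by
  have h1 := rank_add_card_between hu huv
  have h2 := rank_add_card_gt hv
  exact ⟨rfl, by omega, by omega⟩

namespace Family

variable {l r : ℤ} {V : Finset ℕ} {a : ℤ → ℕ} {M : Equiv.Perm ℕ → Mem}
  {S : Equiv.Perm ℕ → State} {A : Equiv.Perm ℕ → ℤ} {X : Equiv.Perm ℕ → ℕ} {α β : ℝ}

theorem sum_first_step (F : Family l r V a M S A X) :
    ∑ g ∈ permsOfFinset V, (cost α β (S g).toMem - cost α β (M g)) = (#V - 2).factorial *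
      ∑ j ∈ range #V, ∑ i ∈ range j,
        (stepMean α β #V i (#V - 1 - j) 0 + stepMean α β #V i (#V - 1 - j) 1) := by
  rw [sum_perms_eq_sum_offDiag F.left_mem F.right_mem F.left_ne_right,
    sum_congr rfl fun e he => F.sum_step (mem_offDiag.1 he).1 (mem_offDiag.1 he).2.1
      (mem_offDiag.1 he).2.2, ← mul_sum,
    sum_offDiag_rank V (fun u v => stepMean α β #V #{w ∈ V | w < min u v} #{w ∈ V | max u v < w}
      (if v < u then 1 else 0)) (fun i j => stepMean α β #V i (#V - 1 - j) 0 +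
        stepMean α β #V i (#V - 1 - j) 1)]
  intro u hu v hv huv
  obtain ⟨e1, -, e3⟩ := rank_data hu hv huv
  simp only [min_eq_left huv.le, min_eq_right huv.le, max_eq_right huv.le, max_eq_left huv.le,
    if_neg huv.not_gt, if_pos huv, e1, e3]

theorem sum_all_recursion (F : Family l r V a M S A X) {C : ℕ → ℝ}
    (hC : ∀ k < #V, IsMeanCost α β k (C k)) :
    ∑ g ∈ permsOfFinset V, (cost α β (sorted (M g) l r) - cost α β (S g).toMem) =
      (#V - 2).factorial *
      ∑ j ∈ range #V, ∑ i ∈ range j, 2 * (C i + C (j - 1 - i) + C (#V - 1 - j)) := by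
  have hlt : ∀ u ∈ V, ∀ P : ℕ → Prop, ∀ [DecidablePred P], ¬ P u → #{w ∈ V | P w} < #V :=
    fun u hu P _ hP => card_lt_card (filter_ssubset.2 ⟨u, hu, hP⟩)
  rw [sum_perms_eq_sum_offDiag F.left_mem F.right_mem F.left_ne_right,
    sum_congr rfl fun e he => F.sum_recursion (mem_offDiag.1 he).1 (mem_offDiag.1 he).2.1
      (mem_offDiag.1 he).2.2 (hC _ (hlt _ (mem_offDiag.1 he).1 _ (by simp)))
      (hC _ (hlt _ (mem_offDiag.1 he).1 _ (by omega)))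
      (hC _ (hlt _ (mem_offDiag.1 he).1 _ (by simp))), ← mul_sum,
    sum_offDiag_rank V (fun u v => C #{w ∈ V | w < min u v} +
      C #{w ∈ V | min u v < w ∧ w < max u v} + C #{w ∈ V | max u v < w})
      (fun i j => 2 * (C i + C (j - 1 - i) + C (#V - 1 - j)))]
  intro u hu v hv huv
  obtain ⟨e1, e2, e3⟩ := rank_data hu hv huv
  simp only [min_eq_left huv.le, min_eq_right huv.le, max_eq_right huv.le, max_eq_left huv.le,
    e1, e2, e3]
  ring

end Family

/-- A solution of the Quicksort recurrence is the sequence of mean costs. -/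
theorem isMeanCost_of_recurrence {α β : ℝ} {C : ℕ → ℝ} (h0 : C 0 = 0) (h1 : C 1 = 0)
    (hC : ∀ k, 2 ≤ k → ∑ j ∈ range k, ∑ i ∈ range j,
      (stepMean α β k i (k - 1 - j) 0 + stepMean α β k i (k - 1 - j) 1) +
      ∑ j ∈ range k, ∑ i ∈ range j, 2 * (C i + C (j - 1 - i) + C (k - 1 - j)) =
        k * (k - 1) * C k) (k : ℕ) : IsMeanCost α β k (C k) := by
  induction k using Nat.strong_induction_on with
  | _ k ih =>
  intro l r V a M hV hr bij arr
  rcases lt_or_ge k 2 with hk | hk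
  · have hz : ∀ g ∈ permsOfFinset V, cost α β (sorted (M g) l r) - cost α β (M g) = 0 :=
      fun g _ => by rw [sorted_of_le (by omega), sub_self]
    rw [sum_congr rfl hz, sum_const_zero]
    interval_cases k <;> simp [h0, h1]
  · obtain ⟨S, A, X, F⟩ := exists_family (by omega) bij arr
    subst hV
    have e1 := F.sum_first_step (α := α) (β := β)
    have e2 := F.sum_all_recursion ih
    have e3 : ∑ g ∈ permsOfFinset V, (cost α β (sorted (M g) l r) - cost α β (M g)) =
        (#V - 2).factorial * (#V * (#V - 1) * C #V) := by
      rw [← hC _ hk, mul_add, ← e1, ← e2, ← sum_add_distrib]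
      exact sum_congr rfl fun g _ => by ring
    rw [e3]
    -- The factor `(k-2)!` counts the arrangements with given pivots, and `k(k-1)(k-2)! = k!`.
    obtain ⟨n, hn⟩ : ∃ n, #V = n + 2 := ⟨#V - 2, by omega⟩
    rw [hn, Nat.add_sub_cancel, Nat.factorial_succ, Nat.factorial_succ]
    push_cast
    ring

/-! ### Solution of the recurrence. -/

/-- For sums over the numbers of small and large keys: the pairs of ranks with at least one medium
key among `k + 1` keys correspond to all pairs among `k` keys, and the last sum stands for the pairs
of adjacent ranks. -/
theorem pairSum_succ (f : ℕ → ℕ → ℝ) (k : ℕ) :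
    ∑ j ∈ range (k + 1), ∑ i ∈ range j, f i (k + 1 - 1 - j) =
      ∑ j ∈ range k, ∑ i ∈ range j, f i (k - 1 - j) + ∑ j ∈ range k, f j (k - 1 - j) := by
  rw [sum_range_succ', range_zero, sum_empty, add_zero, ← sum_add_distrib]
  refine sum_congr rfl fun j _ => ?_
  rw [sum_range_succ, show k + 1 - 1 - (j + 1) = k - 1 - j by omega]

theorem pairSum_one (k : ℕ) : ∑ j ∈ range k, ∑ _i ∈ range j, (1 : ℝ) = k * (k - 1) / 2 := by
  induction k with
  | zero => simp
  | succ k ih =>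
    rw [sum_range_succ, ih]
    simp
    ring

theorem pairSum_add (k : ℕ) :
    ∑ j ∈ range k, ∑ i ∈ range j, ((i : ℝ) + (k - 1 - j : ℕ)) = k * (k - 1) * (k - 2) / 3 := by
  induction k with
  | zero => simp
  | succ k ih =>
    have h : ∀ j ∈ range k, ((j : ℝ) + (k - 1 - j : ℕ)) = k - 1 := fun j hj => by
      rw [mem_range] at hj
      rw [← Nat.cast_add, show j + (k - 1 - j) = k - 1 by omega, Nat.cast_sub (by omega)]
      simp
    rw [pairSum_succ (fun i L => (i : ℝ) + L), ih, sum_congr rfl h]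
    simp
    ring

theorem sum_mul_reflect (k : ℕ) :
    ∑ j ∈ range k, (j : ℝ) * (k - 1 - j : ℕ) = k * (k - 1) * (k - 2) / 6 := by
  have h : ∀ n : ℕ, ∑ j ∈ range n, (j : ℝ) = n * (n - 1) / 2 := fun n => by
    induction n with
    | zero => simp
    | succ n ih =>
      rw [sum_range_succ, ih]
      push_cast
      ring
  induction k with
  | zero => simp
  | succ k ih =>
    have h' : ∀ j ∈ range k, (j : ℝ) * (k + 1 - 1 - j : ℕ) = j * (k - 1 - j : ℕ) + j := fun j hj => by
      rw [mem_range] at hj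
      rw [show k + 1 - 1 - j = (k - 1 - j) + 1 by omega]
      push_cast
      ring
    rw [sum_range_succ, sum_congr rfl h', sum_add_distrib, ih, h]
    simp
    ring

/-- In the step from `k` to `k + 1` the new terms have no medium key, so they share the denominator
`k - 1` and their sum is elementary. -/
theorem pairSum_exch {k : ℕ} (hk : 2 ≤ k) :
    ∑ j ∈ range k, ∑ i ∈ range j, ((i : ℝ) * (k - 1 - j : ℕ) / (i + (k - 1 - j) : ℕ)) =
      (k - 2) * (k - 3) * (2 * k + 1) / 36 := by
  induction k, hk using Nat.le_induction with
  | base => norm_num [sum_range_succ]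
  | succ k hk ih =>
    have h : ∀ j ∈ range k, ((j : ℝ) * (k - 1 - j : ℕ) / (j + (k - 1 - j) : ℕ)) =
        (j : ℝ) * (k - 1 - j : ℕ) / (k - 1) := fun j hj => by
      rw [mem_range] at hj
      rw [show j + (k - 1 - j) = k - 1 by omega, Nat.cast_sub (m := 1) (n := k) (by omega)]
      simp
    rw [pairSum_succ (fun i L => (i : ℝ) * L / (i + L : ℕ)), ih, sum_congr rfl h, ← sum_div,
      sum_mul_reflect]
    have : (k : ℝ) - 1 ≠ 0 := by
      have : (2 : ℝ) ≤ k := by exact_mod_cast hk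
      linarith
    push_cast
    field_simp
    ring

theorem sum_stepMean (α β : ℝ) {k : ℕ} (hk : 2 ≤ k) : ∑ j ∈ range k, ∑ i ∈ range j,
      (stepMean α β k i (k - 1 - j) 0 + stepMean α β k i (k - 1 - j) 1) =
    α * (2 * k * (k - 1) ^ 2 - (k - 2) * (k - 3) * (2 * k + 1) / 9) +
      β * (5 * k * (k - 1) / 2 + 2 * k * (k - 1) * (k - 2) / 3) := by
  have h : ∀ j ∈ range k, ∑ i ∈ range j,
      (stepMean α β k i (k - 1 - j) 0 + stepMean α β k i (k - 1 - j) 1) =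
      (4 * α * (k - 1) + 5 * β) * ∑ _i ∈ range j, (1 : ℝ) +
        (-4 * α) * ∑ i ∈ range j, ((i : ℝ) * (k - 1 - j : ℕ) / (i + (k - 1 - j) : ℕ)) +
        2 * β * ∑ i ∈ range j, ((i : ℝ) + (k - 1 - j : ℕ)) := fun j _ => by
    rw [mul_sum, mul_sum, mul_sum, ← sum_add_distrib, ← sum_add_distrib]
    refine sum_congr rfl fun i _ => ?_
    unfold stepMean
    ring
  rw [sum_congr rfl h, sum_add_distrib, sum_add_distrib, ← mul_sum, ← mul_sum, ← mul_sum,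
    pairSum_one, pairSum_exch hk, pairSum_add]
  ring

/-- By symmetry the three subfile sizes have the same distribution. -/
theorem sum_recursive (C : ℕ → ℝ) (k : ℕ) :
    ∑ j ∈ range k, ∑ i ∈ range j, 2 * (C i + C (j - 1 - i) + C (k - 1 - j)) =
      6 * ∑ j ∈ range k, ∑ i ∈ range j, C i := by
  have h1 : ∑ j ∈ range k, ∑ i ∈ range j, C (j - 1 - i) = ∑ j ∈ range k, ∑ i ∈ range j, C i :=
    sum_congr rfl fun j _ => sum_range_reflect C j
  have h2 : ∑ j ∈ range k, ∑ i ∈ range j, C (k - 1 - j) = ∑ j ∈ range k, ∑ i ∈ range j, C i := by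
    induction k with
    | zero => rfl
    | succ k ih =>
      rw [pairSum_succ (fun _ L => C L), ih (sum_congr rfl fun j _ => sum_range_reflect C j),
        sum_range_succ, sum_range_reflect]
  simp_rw [← mul_sum, sum_add_distrib]
  rw [h1, h2]
  ring

/-- A double sum is determined by its second difference and, at `n₀`, its value and first
difference. It is used with `n₀ = 4`, where the closed forms begin. -/
theorem double_sum_eq {C R : ℕ → ℝ} {n₀ : ℕ}
    (h : ∀ n, n₀ ≤ n → 6 * C n = R (n + 2) - 2 * R (n + 1) + R n)
    (h1 : 6 * ∑ i ∈ range n₀, C i = R (n₀ + 1) - R n₀)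
    (h2 : 6 * ∑ j ∈ range n₀, ∑ i ∈ range j, C i = R n₀) {n : ℕ} (hn : n₀ ≤ n) :
    6 * ∑ j ∈ range n, ∑ i ∈ range j, C i = R n := by
  suffices H : 6 * ∑ i ∈ range n, C i = R (n + 1) - R n ∧
      6 * ∑ j ∈ range n, ∑ i ∈ range j, C i = R n from H.2
  induction n, hn using Nat.le_induction with
  | base => exact ⟨h1, h2⟩
  | succ n hn ih =>
    obtain ⟨i1, i2⟩ := ih
    rw [sum_range_succ, sum_range_succ]
    constructor
    · linarith [h n hn]
    · linarith

/-- The mean number of comparisons. -/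
noncomputable def meanComps (n : ℕ) : ℝ :=
  if n < 2 then 0 else if n = 2 then 2 else if n = 3 then 4 else
    32 / 15 * ((n : ℝ) + 1) * (harmonic (n + 1) : ℝ) - 856 / 225 * ((n : ℝ) + 1) + 3 / 2

/-- The mean number of swaps. -/
noncomputable def meanSwaps (n : ℕ) : ℝ :=
  if n < 2 then 0 else if n = 2 then 5 / 2 else if n = 3 then 19 / 6 else
    4 / 5 * ((n : ℝ) + 1) * (harmonic (n + 1) : ℝ) - 19 / 25 * ((n : ℝ) + 1) - 1 / 4

theorem meanComps_of_le {n : ℕ} (hn : 4 ≤ n) : meanComps n =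
    32 / 15 * ((n : ℝ) + 1) * (harmonic (n + 1) : ℝ) - 856 / 225 * ((n : ℝ) + 1) + 3 / 2 := by
  rw [meanComps, if_neg (by omega), if_neg (by omega), if_neg (by omega)]

theorem meanSwaps_of_le {n : ℕ} (hn : 4 ≤ n) : meanSwaps n =
    4 / 5 * ((n : ℝ) + 1) * (harmonic (n + 1) : ℝ) - 19 / 25 * ((n : ℝ) + 1) - 1 / 4 := by
  rw [meanSwaps, if_neg (by omega), if_neg (by omega), if_neg (by omega)]

theorem isMeanCost_comps (k : ℕ) : IsMeanCost 1 0 k (meanComps k) := by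
  refine isMeanCost_of_recurrence (by simp [meanComps]) (by simp [meanComps]) (fun k hk => ?_) k
  rw [sum_stepMean 1 0 hk, sum_recursive]
  rcases lt_or_ge k 4 with hk4 | hk4
  · interval_cases k <;> norm_num [meanComps, sum_range_succ]
  -- `R n` is what the recurrence demands of the double sum: `n(n-1)` times the closed form, minus
  -- the contribution of the partitioning step.
  · rw [meanComps_of_le hk4, double_sum_eq (n₀ := 4) (R := fun n => (n : ℝ) * (n - 1) *
      (32 / 15 * ((n : ℝ) + 1) * (harmonic (n + 1) : ℝ) - 856 / 225 * ((n : ℝ) + 1) + 3 / 2) -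
      (2 * n * (n - 1) ^ 2 - (n - 2) * (n - 3) * (2 * n + 1) / 9)) ?_ ?_ ?_ hk4]
    · ring
    · intro n hn
      rw [meanComps_of_le hn]
      have h2 : (n : ℝ) + 1 + 1 ≠ 0 := by positivity
      have h3 : (n : ℝ) + 2 + 1 ≠ 0 := by positivity
      simp only [harmonic_succ (n + 2), harmonic_succ (n + 1)]
      push_cast
      field_simp
      ring
    · norm_num [meanComps, sum_range_succ, harmonic]
    · norm_num [meanComps, sum_range_succ, harmonic]

theorem isMeanCost_swaps (k : ℕ) : IsMeanCost 0 1 k (meanSwaps k) := by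
  refine isMeanCost_of_recurrence (by simp [meanSwaps]) (by simp [meanSwaps]) (fun k hk => ?_) k
  rw [sum_stepMean 0 1 hk, sum_recursive]
  rcases lt_or_ge k 4 with hk4 | hk4
  · interval_cases k <;> norm_num [meanSwaps, sum_range_succ]
  · rw [meanSwaps_of_le hk4, double_sum_eq (n₀ := 4) (R := fun n => (n : ℝ) * (n - 1) *
      (4 / 5 * ((n : ℝ) + 1) * (harmonic (n + 1) : ℝ) - 19 / 25 * ((n : ℝ) + 1) - 1 / 4) -
      (5 * n * (n - 1) / 2 + 2 * n * (n - 1) * (n - 2) / 3)) ?_ ?_ ?_ hk4]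
    · ring
    · intro n hn
      rw [meanSwaps_of_le hn]
      have h2 : (n : ℝ) + 1 + 1 ≠ 0 := by positivity
      have h3 : (n : ℝ) + 2 + 1 ≠ 0 := by positivity
      simp only [harmonic_succ (n + 2), harmonic_succ (n + 1)]
      push_cast
      field_simp
      ring
    · norm_num [meanSwaps, sum_range_succ, harmonic]
    · norm_num [meanSwaps, sum_range_succ, harmonic]

/-! ### Bounds for the Euler–Mascheroni constant, and the asymptotic expansion. -/

/-- Rounding `c/(k+1)` to integers reduces bounds for harmonic numbers to integer arithmetic that
the kernel evaluates. -/
theorem sum_div_le_harmonic (c n : ℕ) :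
    ((∑ k ∈ range n, c / (k + 1) : ℕ) : ℝ) ≤ c * (harmonic n : ℝ) := by
  rw [harmonic, Nat.cast_sum, Rat.cast_sum, mul_sum]
  refine sum_le_sum fun k _ => Nat.cast_div_le.trans ?_
  push_cast
  rw [div_eq_mul_inv]

theorem harmonic_le_sum_div (c n : ℕ) :
    c * (harmonic n : ℝ) ≤ (∑ k ∈ range n, (c / (k + 1) + 1) : ℕ) := by
  rw [harmonic, Nat.cast_sum, Rat.cast_sum, mul_sum]
  refine sum_le_sum fun k _ => ?_
  push_cast
  rw [← div_eq_mul_inv, div_le_iff₀ (by positivity)]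
  exact_mod_cast (Nat.lt_div_mul_add (a := c) (b := k + 1) (by omega)).le.trans
    (by rw [add_mul, one_mul])

theorem harmonic_1023_gt : (7.5081 : ℝ) < (harmonic 1023 : ℝ) := by
  have c1 : 612434000 ≤ ∑ k ∈ range 256, 100000000 / (k + 1) := by decide +kernel
  have c2 : 69217000 ≤ ∑ k ∈ range 256, 100000000 / (256 + k + 1) := by decide +kernel
  have c3 : 40513000 ≤ ∑ k ∈ range 256, 100000000 / (256 + 256 + k + 1) := by decide +kernel
  have c4 : 28654000 ≤ ∑ k ∈ range 255, 100000000 / (256 + 256 + 256 + k + 1) := by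
    decide +kernel
  have h := sum_div_le_harmonic 100000000 (256 + 256 + 256 + 255)
  rw [sum_range_add, sum_range_add, sum_range_add] at h
  generalize ∑ k ∈ range 256, 100000000 / (k + 1) = s1 at *
  generalize ∑ k ∈ range 256, 100000000 / (256 + k + 1) = s2 at *
  generalize ∑ k ∈ range 256, 100000000 / (256 + 256 + k + 1) = s3 at *
  generalize ∑ k ∈ range 255, 100000000 / (256 + 256 + 256 + k + 1) = s4 at *
  rw [show 1023 = 256 + 256 + 256 + 255 by rfl]
  generalize (harmonic (256 + 256 + 256 + 255) : ℝ) = H at *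
  have h1 : ((750818000 : ℕ) : ℝ) ≤ ((s1 + s2 + s3 + s4 : ℕ) : ℝ) := Nat.cast_le.2 (by omega)
  have h2 := h1.trans h
  norm_num at h2
  linarith

theorem harmonic_256_lt : (harmonic 256 : ℝ) < 6.1260 := by
  have h1 : ∑ k ∈ range 256, (100000000 / (k + 1) + 1) < 612600000 := by decide +kernel
  have h := harmonic_le_sum_div 100000000 256
  generalize ∑ k ∈ range 256, (100000000 / (k + 1) + 1) = s at *
  generalize (harmonic 256 : ℝ) = H at *
  have h2 : (s : ℝ) < (612600000 : ℕ) := Nat.cast_lt.2 h1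
  have h3 := h.trans_lt h2
  norm_num at h3
  linarith

/-- The rounding `-2.57` requires `0.5763 < γ < 0.5809…`. The indices 1023 here and 256 below make
the logarithms multiples of `log 2`, as the lower sequence is `H_n - log (n+1)` and the upper one
`H_n - log n`. -/
theorem eulerMascheroniConstant_gt : 0.5766 < Real.eulerMascheroniConstant := by
  have h := Real.eulerMascheroniSeq_lt_eulerMascheroniConstant 1023
  have h2 : Real.log ((1023 : ℕ) + 1) = 10 * Real.log 2 := by
    rw [show (((1023 : ℕ) : ℝ) + 1) = 2 ^ 10 by norm_num, Real.log_pow]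
    norm_num
  rw [Real.eulerMascheroniSeq, h2] at h
  have := harmonic_1023_gt
  have := Real.log_two_lt_d9
  linarith

theorem eulerMascheroniConstant_lt : Real.eulerMascheroniConstant < 0.5809 := by
  have h := Real.eulerMascheroniConstant_lt_eulerMascheroniSeq' 256
  have h2 : Real.log (256 : ℕ) = 8 * Real.log 2 := by
    rw [show ((256 : ℕ) : ℝ) = 2 ^ 8 by norm_num, Real.log_pow]
    norm_num
  rw [Real.eulerMascheroniSeq', if_neg (by norm_num), h2] at h
  have := harmonic_256_lt
  have := Real.log_two_gt_d9
  linarith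

/-- The asymptotic expansion of `c (n + 1) Hₙ₊₁ - d (n + 1) + e`. -/
theorem isBigO_harmonic (c d e : ℝ) {f : ℕ → ℝ} (hf : ∀ n : ℕ, 4 ≤ n →
      f n = c * ((n : ℝ) + 1) * (harmonic (n + 1) : ℝ) - d * ((n : ℝ) + 1) + e) :
    (fun n : ℕ => f n - (c * (n : ℝ) * Real.log n +
      (c * Real.eulerMascheroniConstant - d) * (n : ℝ))) =O[atTop] fun n : ℕ => Real.log n := by
  -- The bracket `log n + γ + (n+1)δ + 1` that multiplies `c` is at most `log n + 2/3 + 2 + 1`,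
  -- which is below `5 log n` because `log n ≥ 1` for `n ≥ 4`.
  refine IsBigO.of_bound (5 * |c| + |d| + |e|) ?_
  filter_upwards [eventually_ge_atTop 4] with n hn
  have hn' : (4 : ℝ) ≤ n := by exact_mod_cast hn
  have hlog : 1 ≤ Real.log n := by
    rw [Real.le_log_iff_exp_le (by linarith)]
    linarith [Real.exp_one_lt_d9]
  have h1 := Real.eulerMascheroniSeq_lt_eulerMascheroniConstant n
  have h2 := Real.eulerMascheroniConstant_lt_eulerMascheroniSeq' n
  rw [Real.eulerMascheroniSeq] at h1
  rw [Real.eulerMascheroniSeq', if_neg (by omega)] at h2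
  have h3 : Real.log ((n : ℝ) + 1) - Real.log n ≤ 1 / n := by
    rw [← Real.log_div (by linarith) (by linarith)]
    refine (Real.log_le_sub_one_of_pos (by positivity)).trans (le_of_eq ?_)
    field_simp
    ring
  have h4 := Real.one_half_lt_eulerMascheroniConstant
  have h5 := Real.eulerMascheroniConstant_lt_two_thirds
  set δ : ℝ := (harmonic n : ℝ) - Real.log n - Real.eulerMascheroniConstant with hδ
  have hδ0 : 0 ≤ δ := by linarith
  have hδ1 : (n + 1) * δ ≤ 2 := by
    have h6 : δ ≤ 1 / n := by linarith
    calc ((n : ℝ) + 1) * δ ≤ (n + 1) * (1 / n) := by gcongr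
      _ ≤ 2 := by
        rw [mul_one_div, div_le_iff₀ (by linarith)]
        linarith
  have hδ2 : 0 ≤ (n + 1) * δ := by positivity
  have hH : (harmonic (n + 1) : ℝ) = Real.log n + Real.eulerMascheroniConstant + δ + 1 / (n + 1) := by
    rw [harmonic_succ]
    push_cast
    rw [hδ]
    ring
  have key : f n - (c * (n : ℝ) * Real.log n + (c * Real.eulerMascheroniConstant - d) * (n : ℝ)) =
      c * (Real.log n + Real.eulerMascheroniConstant + (n + 1) * δ + 1) + (-d) + e := by
    rw [hf n hn, hH]
    field_simp
    ring
  rw [key, Real.norm_eq_abs, Real.norm_eq_abs, abs_of_nonneg (by linarith : 0 ≤ Real.log n)]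
  have hB : |Real.log n + Real.eulerMascheroniConstant + (n + 1) * δ + 1| ≤ 5 * Real.log n := by
    rw [abs_of_nonneg (by linarith)]
    linarith
  calc _ ≤ |c * (Real.log n + Real.eulerMascheroniConstant + (n + 1) * δ + 1)| + |(-d)| + |e| :=
        abs_add_three _ _ _
    _ ≤ |c| * (5 * Real.log n) + |d| * Real.log n + |e| * Real.log n := by
        rw [abs_mul, abs_neg]
        gcongr
        · exact le_mul_of_one_le_right (abs_nonneg _) hlog
        · exact le_mul_of_one_le_right (abs_nonneg _) hlog
    _ = _ := by ring

/-! ### Transfer to permutations of `Fin n`, and the first partitioning step. -/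

/-- `Fin n` as the set of the positions and keys `1, …, n`. -/
def finEquivIcc (n : ℕ) : Fin n ≃ {x : ℕ // x ∈ Icc 1 n} where
  toFun i := ⟨i + 1, mem_Icc.2 ⟨by omega, by omega⟩⟩
  invFun x := ⟨x - 1, by have := mem_Icc.1 x.2; omega⟩
  left_inv i := by ext; simp
  right_inv x := by have := mem_Icc.1 x.2; ext; simp; omega

/-- A permutation of `Fin n` as a permutation of `1, …, n`. -/
def extend {n : ℕ} (π : Equiv.Perm (Fin n)) : Equiv.Perm ℕ := π.extendDomain (finEquivIcc n)

theorem extend_mem {n : ℕ} (π : Equiv.Perm (Fin n)) : extend π ∈ permsOfFinset (Icc 1 n) :=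
  mem_permsOfFinset.2 fun _ hx => Equiv.Perm.extendDomain_apply_not_subtype _ _ hx

theorem extend_apply {n : ℕ} (π : Equiv.Perm (Fin n)) (i : Fin n) :
    extend π (i + 1) = π i + 1 :=
  Equiv.Perm.extendDomain_apply_image π (finEquivIcc n) i

/-- Extension by the identity is injective, and both sides range over `n!` permutations, so it is
onto. -/
theorem sum_extend {n : ℕ} (f : Equiv.Perm ℕ → ℝ) :
    ∑ π : Equiv.Perm (Fin n), f (extend π) = ∑ g ∈ permsOfFinset (Icc 1 n), f g := by
  have hinj : Function.Injective (extend (n := n)) :=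
    Equiv.Perm.extendDomainHom_injective (finEquivIcc n)
  classical
  have himg : univ.image (extend (n := n)) = permsOfFinset (Icc 1 n) := by
    refine eq_of_subset_of_card_le (fun g hg => ?_) ?_
    · obtain ⟨π, -, rfl⟩ := mem_image.1 hg
      exact extend_mem π
    · rw [card_image_of_injective _ hinj, card_perms_of_finset, card_univ, Fintype.card_perm]
      simp
  rw [← himg, sum_image hinj.injOn]

/-- The array which holds `g 1, …, g n`, nothing having been counted yet. -/
def arrangement (n : ℕ) (g : Equiv.Perm ℕ) : Mem where
  arr k := if 1 ≤ k ∧ k ≤ n then g k.toNat else 0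
  comps := 0
  swaps := 0

theorem input_eq {n : ℕ} (π : Equiv.Perm (Fin n)) : input π = arrangement n (extend π) := by
  unfold input arrangement
  congr 1
  funext k
  split_ifs with h
  · rw [← extend_apply]
    congr 1
    simp only
    omega
  · rfl

theorem bijOn_toNat (n : ℕ) : Set.BijOn Int.toNat (Set.Icc 1 (n : ℤ)) (Icc 1 n : Finset ℕ) := by
  refine ⟨fun k hk => ?_, fun k hk k' hk' h => ?_, fun x hx => ⟨x, ?_, by simp⟩⟩
  · rw [Set.mem_Icc] at hk
    exact mem_Icc.2 (by omega)
  · rw [Set.mem_Icc] at hk hk'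
    omega
  · have := mem_Icc.1 hx
    rw [Set.mem_Icc]
    omega

theorem arrangement_arr (n : ℕ) (g : Equiv.Perm ℕ) (t : ℤ) (h : 1 ≤ t) (h' : t ≤ n) :
    (arrangement n g).arr t = g t.toNat :=
  if_pos ⟨h, h'⟩

theorem arrangement_injOn {n : ℕ} {g : Equiv.Perm ℕ} (hg : g ∈ permsOfFinset (Icc 1 n)) :
    Set.InjOn (arrangement n g).arr (Set.Icc 1 n) :=
  (bijOn_arrangement (bijOn_toNat n) hg (arrangement_arr n g)).injOn

theorem run_eq {n : ℕ} (π : Equiv.Perm (Fin n)) :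
    run π = some (sorted (arrangement n (extend π)) 1 n) := by
  rw [run, input_eq, quicksort_eq_some (arrangement_injOn (extend_mem π))]

theorem mean_eq {n : ℕ} (f : Equiv.Perm ℕ → ℕ) :
    mean (fun π : Equiv.Perm (Fin n) => f (extend π)) =
      (∑ g ∈ permsOfFinset (Icc 1 n), (f g : ℝ)) / n.factorial := by
  rw [mean, ← mul_sum, sum_extend (fun g => (f g : ℝ))]
  ring

theorem expComparisons_eq (n : ℕ) : expComparisons n = meanComps n := by
  have h := isMeanCost_comps n 1 n (Icc 1 n) Int.toNat (arrangement n) (by simp) (by ring)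
    (bijOn_toNat n) (fun g _ => arrangement_arr n g)
  simp only [expComparisons, run_eq, Option.map_some, Option.getD_some]
  rw [mean_eq fun g => (sorted (arrangement n g) 1 n).comps, div_eq_iff (by positivity), mul_comm,
    ← h]
  simp [cost, arrangement]

theorem expSwaps_eq (n : ℕ) : expSwaps n = meanSwaps n := by
  have h := isMeanCost_swaps n 1 n (Icc 1 n) Int.toNat (arrangement n) (by simp) (by ring)
    (bijOn_toNat n) (fun g _ => arrangement_arr n g)
  simp only [expSwaps, run_eq, Option.map_some, Option.getD_some]
  rw [mean_eq fun g => (sorted (arrangement n g) 1 n).swaps, div_eq_iff (by positivity), mul_comm,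
    ← h]
  simp [cost, arrangement]

theorem firstStep {n : ℕ} (hn : 2 ≤ n) :
    (∀ π : Equiv.Perm (Fin n), (runFirstStep π).isSome) ∧
      expStepComparisons n =
        16 / 9 * ((n : ℝ) + 1) - 3 - 2 / 3 * (1 / ((n : ℝ) * ((n : ℝ) - 1))) ∧
      expStepSwaps n = 2 / 3 * ((n : ℝ) + 1) + 1 / 2 := by
  obtain ⟨S, A, X, F⟩ := exists_family (by omega) (bijOn_toNat n)
    (fun g _ => arrangement_arr n g)
  have hrun : ∀ π : Equiv.Perm (Fin n), runFirstStep π = some (S (extend π)) := fun π => by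
    rw [runFirstStep, input_eq, F.eq _ (extend_mem π)]
  have h1 := F.sum_first_step (α := 1) (β := 0)
  have h2 := F.sum_first_step (α := 0) (β := 1)
  rw [Nat.card_Icc, Nat.add_sub_cancel, sum_stepMean _ _ hn] at h1 h2
  have h3 : (n.factorial : ℝ) = n * (n - 1) * (n - 2).factorial := by
    obtain ⟨m, rfl⟩ : ∃ m, n = m + 2 := ⟨n - 2, by omega⟩
    rw [Nat.factorial_succ, Nat.factorial_succ]
    push_cast
    ring
  have h4 : (2 : ℝ) ≤ n := by exact_mod_cast hn
  have h5 : (n : ℝ) - 1 ≠ 0 := by linarith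
  have h6 : (n : ℝ) ≠ 0 := by linarith
  refine ⟨fun π => by rw [hrun]; rfl, ?_, ?_⟩
  · simp only [expStepComparisons, hrun, Option.map_some, Option.getD_some]
    rw [mean_eq fun g => (S g).comps, div_eq_iff (by positivity), h3]
    simp only [cost, arrangement, Nat.cast_zero, one_mul, zero_mul, add_zero, sub_zero,
      mul_zero] at h1
    rw [h1]
    field_simp
    ring
  · simp only [expStepSwaps, hrun, Option.map_some, Option.getD_some]
    rw [mean_eq fun g => (S g).swaps, div_eq_iff (by positivity), h3]
    simp only [cost, arrangement, Nat.cast_zero, one_mul, zero_mul, zero_add, sub_zero,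
      mul_zero] at h2
    rw [h2]
    field_simp
    ring

end SedgewickQuicksort

theorem mainTheorem2 :
    -- the program terminates on every permutation, so that its costs are meaningful
    (∀ (n : ℕ) (π : Equiv.Perm (Fin n)), (SedgewickQuicksort.run π).isSome) ∧
    -- comparisons: exact value, asymptotics, and the rounded coefficients `2.13` and `-2.57`
    (∀ n : ℕ, 4 ≤ n → SedgewickQuicksort.expComparisons n =
      32 / 15 * ((n : ℝ) + 1) * (harmonic (n + 1) : ℝ) - 856 / 225 * ((n : ℝ) + 1) + 3 / 2) ∧
    ((fun n : ℕ => SedgewickQuicksort.expComparisons n -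
        (32 / 15 * (n : ℝ) * Real.log n +
          (32 / 15 * Real.eulerMascheroniConstant - 856 / 225) * (n : ℝ)))
      =O[atTop] fun n : ℕ => Real.log n) ∧
    |(32 / 15 : ℝ) - 2.13| < 0.005 ∧
    |(32 / 15 * Real.eulerMascheroniConstant - 856 / 225) - (-2.57)| < 0.005 ∧
    -- swaps: exact value, asymptotics, and the rounded coefficient `-0.30`
    (∀ n : ℕ, 4 ≤ n → SedgewickQuicksort.expSwaps n =
      4 / 5 * ((n : ℝ) + 1) * (harmonic (n + 1) : ℝ) - 19 / 25 * ((n : ℝ) + 1) - 1 / 4) ∧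
    ((fun n : ℕ => SedgewickQuicksort.expSwaps n -
        (4 / 5 * (n : ℝ) * Real.log n +
          (4 / 5 * Real.eulerMascheroniConstant - 19 / 25) * (n : ℝ)))
      =O[atTop] fun n : ℕ => Real.log n) ∧
    |(4 / 5 * Real.eulerMascheroniConstant - 19 / 25) - (-0.30)| < 0.005 ∧
    -- costs of the first partitioning step
    (∀ n : ℕ, 3 ≤ n → (∀ π : Equiv.Perm (Fin n), (SedgewickQuicksort.runFirstStep π).isSome) ∧
      SedgewickQuicksort.expStepComparisons n =
        16 / 9 * ((n : ℝ) + 1) - 3 - 2 / 3 * (1 / ((n : ℝ) * ((n : ℝ) - 1))) ∧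
      SedgewickQuicksort.expStepSwaps n = 2 / 3 * ((n : ℝ) + 1) + 1 / 2) := by
  have hc := fun n (hn : 4 ≤ n) =>
    (SedgewickQuicksort.expComparisons_eq n).trans (SedgewickQuicksort.meanComps_of_le hn)
  have hs := fun n (hn : 4 ≤ n) =>
    (SedgewickQuicksort.expSwaps_eq n).trans (SedgewickQuicksort.meanSwaps_of_le hn)
  have hγ := SedgewickQuicksort.eulerMascheroniConstant_gt
  have hγ' := SedgewickQuicksort.eulerMascheroniConstant_lt
  refine ⟨fun n π => by rw [SedgewickQuicksort.run_eq]; rfl, hc,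
    SedgewickQuicksort.isBigO_harmonic _ _ (3 / 2) hc, ?_, ?_, hs,
    SedgewickQuicksort.isBigO_harmonic _ _ (-(1 / 4)) fun n hn => by rw [hs n hn]; ring, ?_,
    fun n hn => SedgewickQuicksort.firstStep (by omega)⟩
  · rw [abs_lt]
    constructor <;> norm_num
  · rw [abs_lt]
    constructor <;> linarith
  · rw [abs_lt]
    constructor <;> linarith
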